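/- Let $\theta\in(0,\pi/2)$, $\omega\in(0,1/2]$ and $m\in\mathbb Z$. Put \[ \mathsf{Gui}(\theta)=\Big\{(r,z)\in(0,\infty)\times\mathbb R:\ -\tfrac{\pi}{\sin\theta}<z,\ \max(0,z\tan\theta)<r<z\tan\theta+\tfrac{\pi}{\cos\theta}\Big\},\qquad \mathsf{Lay}(\theta)=\mathsf{Gui}(\theta)\times\mathbb S^1 , \] where $\mathbb S^1=\mathbb R/2\pi\mathbb Z$. Let $Q_{\omega,\theta}$ be the closure in $L^2(\mathsf{Lay}(\theta);r\,dr\,dz\,d\phi)$ of the quadratic form \[ u\mapsto\int_{\mathsf{Lay}(\theta)}\Big(|\partial_r u|^2+|\partial_z u|^2+\frac{|i\partial_\phi u-\omega u|^2}{r^2}\Big)r\,dr\,dz\,d\phi,\qquad u\in C_0^\infty(\mathsf{Lay}(\theta)), \] and let $(\pi^{[m]}u)(r,z)=\int_0^{2\pi}u(r,z,\phi)\,(2\pi)^{-1/2}e^{-im\phi}\,d\phi$. The flat fiber form is \[ \mathfrak q^{[m]}_{\omega,\theta}[u]=\int_{\mathsf{Gui}(\theta)}\Big(|\partial_r u|^2+|\partial_z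 u|^2+\frac{(m-\omega)^2-1/4}{r^2}|u|^2\Big)dr\,dz,\qquad \operatorname{dom}\mathfrak q^{[m]}_{\omega,\theta}=\big\{\sqrt r\,\pi^{[m]}u:\ u\in\operatorname{dom}Q_{\omega,\theta}\big\}\subset L^2(\mathsf{Gui}(\theta)), \] with $\partial_r u,\partial_z u$ weak derivatives. Let $H^1_0(\mathsf{Gui}(\theta))$ be the closure of $C_0^\infty(\mathsf{Gui}(\theta))$ in $H^1(\mathsf{Gui}(\theta))$. Then \[ \operatorname{dom}\mathfrak q^{[m]}_{\omega,\theta}=H^1_0(\mathsf{Gui}(\theta)). \] Moreover, $\int_{\mathsf{Gui}(\theta)}|u|^2r^{-2}\,dr\,dz<\infty$ and $\mathfrak q^{[m]}_{\omega,\theta}[u]\ge0$ for every $u\in\operatorname{dom}\mathfrak q^{[m]}_{\omega,\theta}$; and with $\|u\|_{+1,m}^2=\mathfrak q^{[m]}_{\omega,\theta}[u]+\|u\|^2_{L^2(\mathsf{Gui}(\theta))}$, the space $C_0^\infty(\mathsf{Gui}(\theta))$ is a form core, that is, it is contained in $\operatorname{dom}\mathfrak q^{[m]}_{\omega,\theta}$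 and dense there for $\|\cdot\|_{+1,m}$, and there are constants $C_1,C_2>0$, depending only on $\omega,\theta,m$, such that \[ C_1\|u\|_{H^1(\mathsf{Gui}(\theta))}\le\|u\|_{+1,m}\le C_2\|u\|_{H^1(\mathsf{Gui}(\theta))}\qquad\text{for all }u\in\operatorname{dom}\mathfrak q^{[m]}_{\omega,\theta}. \] -/

import Mathlib

open MeasureTheory Filter Topology
open scoped ComplexConjugate

noncomputable section

namespace ConicalLayer

/-! ### The geometry -/

/-- The meridian domain `Gui(θ)`; a point is `p = (r, z)`. -/
def Gui (θ : ℝ) : Set (ℝ × ℝ) :=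
  {p | 0 < p.1 ∧ -(Real.pi / Real.sin θ) < p.2 ∧ max 0 (p.2 * Real.tan θ) < p.1 ∧
    p.1 < p.2 * Real.tan θ + Real.pi / Real.cos θ}

/-- The circle `𝕊¹ = ℝ / 2πℤ`; its `volume` is `dφ`, of total mass `2π`. -/
abbrev S1 : Type := AddCircle (2 * Real.pi)

instance factTwoPiPos : Fact (0 < 2 * Real.pi) := ⟨Real.two_pi_pos⟩

/-- `dr dz` on `Gui(θ)`. -/
def flatMeasure (θ : ℝ) : Measure (ℝ × ℝ) := volume.restrict (Gui θ)

/-- `r dr dz` on `Gui(θ)`. -/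
def radialMeasure (θ : ℝ) : Measure (ℝ × ℝ) :=
  (flatMeasure θ).withDensity fun p => ENNReal.ofReal p.1

/-- `r dr dz dφ` on `Lay(θ) = Gui(θ) × 𝕊¹`. -/
def layerMeasure (θ : ℝ) : Measure ((ℝ × ℝ) × S1) := (radialMeasure θ).prod volume

/-- `L²(Gui(θ))`. -/
abbrev L2Flat (θ : ℝ) := Lp ℂ 2 (flatMeasure θ)

/-- `L²(Gui(θ); r dr dz)`. -/
abbrev L2Radial (θ : ℝ) := Lp ℂ 2 (radialMeasure θ)

/-- `L²_cyl(Lay(θ)) = L²(Gui(θ) × 𝕊¹; r dr dz dφ)`. -/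
abbrev L2Layer (θ : ℝ) := Lp ℂ 2 (layerMeasure θ)

/-! ### The form on the layer and its closure -/

/-- `v ∈ C₀^∞(Lay(θ))`. Smoothness on `ℝ² × 𝕊¹` is smoothness of the lift to `ℝ² × ℝ`. -/
structure IsLayerTest (θ : ℝ) (v : (ℝ × ℝ) × S1 → ℂ) : Prop where
  smooth : ContDiff ℝ ((⊤ : ℕ∞) : WithTop ℕ∞) (fun x : (ℝ × ℝ) × ℝ => v (x.1, (x.2 : S1)))
  compact : HasCompactSupport v
  support : tsupport v ⊆ Gui θ ×ˢ Set.univ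

/-- Classical `∂_r` in the layer. -/
def layerDr (v : (ℝ × ℝ) × S1 → ℂ) (x : (ℝ × ℝ) × S1) : ℂ :=
  fderiv ℝ (fun p => v (p, x.2)) x.1 (1, 0)

/-- Classical `∂_z` in the layer. -/
def layerDz (v : (ℝ × ℝ) × S1 → ℂ) (x : (ℝ × ℝ) × S1) : ℂ :=
  fderiv ℝ (fun p => v (p, x.2)) x.1 (0, 1)

/-- Classical `∂_φ` in the layer. -/
def layerDphi (v : (ℝ × ℝ) × S1 → ℂ) (x : (ℝ × ℝ) × S1) : ℂ :=
  deriv (fun t : ℝ => v (x.1, x.2 + (t : S1))) 0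

/-- The minimal form `‖(i∇ - A_ω) v‖²` on `C₀^∞(Lay(θ))`, with `A_ω = (ω / r) e_φ`,
in cylindrical coordinates. -/
def layerForm (θ ω : ℝ) (v : (ℝ × ℝ) × S1 → ℂ) : ℝ :=
  ∫ x, (‖layerDr v x‖ ^ 2 + ‖layerDz v x‖ ^ 2
    + ‖Complex.I * layerDphi v x - (ω : ℂ) * v x‖ ^ 2 / x.1.1 ^ 2) ∂(layerMeasure θ)

/-- The domain of the closure of the (closable) form `layerForm θ ω` on `C₀^∞(Lay(θ))`: the
`L²`-limits of sequences in `C₀^∞(Lay(θ))` that are Cauchy for the form. -/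
def layerFormDomain (θ ω : ℝ) : Set (L2Layer θ) :=
  {u | ∃ v : ℕ → (ℝ × ℝ) × S1 → ℂ, (∀ n, IsLayerTest θ (v n)) ∧
    Tendsto (fun n => eLpNorm (fun x => v n x - u x) 2 (layerMeasure θ)) atTop (𝓝 0) ∧
    Tendsto (fun k : ℕ × ℕ => layerForm θ ω (fun x => v k.1 x - v k.2 x)) atTop (𝓝 0)}

/-! ### The fibers -/

/-- `v_m(φ) = (2π)^{-1/2} e^{imφ}`. -/
def angularMode (m : ℤ) (φ : S1) : ℂ := ((Real.sqrt (2 * Real.pi) : ℝ) : ℂ)⁻¹ * fourier m φ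

/-- `(π^{[m]} u)(r, z) = ⟨u(r, z, ·), v_m⟩_{L²(𝕊¹)}`. -/
def angularProj (m : ℤ) (u : (ℝ × ℝ) × S1 → ℂ) (p : ℝ × ℝ) : ℂ :=
  ∫ φ : S1, u (p, φ) * conj (angularMode m φ)

/-- `dom 𝔣^{[m]}_{ω,θ} = π^{[m]}(dom Q_{ω,θ})`. -/
def fiberFormDomain (θ ω : ℝ) (m : ℤ) : Set (L2Radial θ) :=
  {w | ∃ u ∈ layerFormDomain θ ω, w =ᵐ[radialMeasure θ] angularProj m u}

/-- `dom 𝔮^{[m]}_{ω,θ} = U(dom 𝔣^{[m]}_{ω,θ})`, where `U w = √r w`. -/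
def flatFormDomain (θ ω : ℝ) (m : ℤ) : Set (L2Flat θ) :=
  {u | ∃ w ∈ fiberFormDomain θ ω m,
    u =ᵐ[flatMeasure θ] fun p => ((Real.sqrt p.1 : ℝ) : ℂ) * w p}

/-! ### Sobolev spaces on the meridian domain -/

/-- `φ ∈ C₀^∞(Gui(θ))`. -/
structure IsGuiTest (θ : ℝ) (φ : ℝ × ℝ → ℂ) : Prop where
  smooth : ContDiff ℝ ((⊤ : ℕ∞) : WithTop ℕ∞) φ
  compact : HasCompactSupport φ
  support : tsupport φ ⊆ Gui θ

/-- `C₀^∞(Gui(θ))` as a subset of `L²(Gui(θ))`. -/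
def testClasses (θ : ℝ) : Set (L2Flat θ) :=
  {u | ∃ φ, IsGuiTest θ φ ∧ u =ᵐ[flatMeasure θ] φ}

/-- `g` is the weak derivative of `u` in the direction `e` on `Gui(θ)`. -/
def IsWeakPartial (θ : ℝ) (e : ℝ × ℝ) (u g : L2Flat θ) : Prop :=
  ∀ φ, IsGuiTest θ φ →
    ∫ p, u p * fderiv ℝ φ p e ∂(flatMeasure θ) = -∫ p, g p * φ p ∂(flatMeasure θ)

open Classical in
/-- The weak derivative in `L²(Gui(θ))` in the direction `e`, where it exists (else `0`). -/
def weakPartial (θ : ℝ) (e : ℝ × ℝ) (u : L2Flat θ) : L2Flat θ :=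
  if h : ∃ g, IsWeakPartial θ e u g then h.choose else 0

/-- `H¹(Gui(θ))`. -/
def H1 (θ : ℝ) : Set (L2Flat θ) :=
  {u | (∃ g, IsWeakPartial θ (1, 0) u g) ∧ ∃ g, IsWeakPartial θ (0, 1) u g}

/-- The norm of `H¹(Gui(θ))`. -/
def h1Norm (θ : ℝ) (u : L2Flat θ) : ℝ :=
  Real.sqrt (‖u‖ ^ 2 + ‖weakPartial θ (1, 0) u‖ ^ 2 + ‖weakPartial θ (0, 1) u‖ ^ 2)

/-- `H₀¹(Gui(θ))`: the closure of `C₀^∞(Gui(θ))` in `H¹(Gui(θ))`. -/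
def H10 (θ : ℝ) : Set (L2Flat θ) :=
  {u | u ∈ H1 θ ∧ ∃ φ : ℕ → L2Flat θ, (∀ n, φ n ∈ testClasses θ) ∧
    Tendsto (fun n => h1Norm θ (φ n - u)) atTop (𝓝 0)}

/-! ### The flat fiber form -/

/-- The value `𝔮^{[m]}_{ω,θ}[u]`. -/
def flatForm (θ ω : ℝ) (m : ℤ) (u : L2Flat θ) : ℝ :=
  ∫ p, (‖weakPartial θ (1, 0) u p‖ ^ 2 + ‖weakPartial θ (0, 1) u p‖ ^ 2
    + (((m : ℝ) - ω) ^ 2 - 1 / 4) / p.1 ^ 2 * ‖u p‖ ^ 2) ∂(flatMeasure θ)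

/-- The form norm `‖u‖_{+1,m}`. -/
def flatFormNorm (θ ω : ℝ) (m : ℤ) (u : L2Flat θ) : ℝ :=
  Real.sqrt (flatForm θ ω m u + ‖u‖ ^ 2)

/-- `C₀^∞(Gui(θ))` is a core of the form `𝔮^{[m]}_{ω,θ}`. -/
def TestIsFormCore (θ ω : ℝ) (m : ℤ) : Prop :=
  testClasses θ ⊆ flatFormDomain θ ω m ∧
  ∀ u ∈ flatFormDomain θ ω m, ∃ φ : ℕ → L2Flat θ, (∀ n, φ n ∈ testClasses θ) ∧
    Tendsto (fun n => flatFormNorm θ ω m (φ n - u)) atTop (𝓝 0)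

end ConicalLayer

end

/-!
Write `q_c[w] = ∫ (|∂_r w|² + |∂_z w|² + c |w|² / r²) r dr dz` for the form of one angular mode. On
test functions the substitution `u = √r w` turns it into `∫ |∇u|² + (c - 1/4) ∫ |u|² / r²` over the
guide, and since the guide lies in `r > 0`, Hardy's inequality `∫ |u|² / r² ≤ 4 ∫ |∂_r u|²` makes
this comparable to the Dirichlet integral as soon as `c > 0`. Hence `w` is in the form domain of
`q_c` exactly when `√r w` is in `H₀¹`, for every `c > 0`.

The closed layer form is reduced to `q_c` along approximating sequences of test functions: the
angular projection commutes with `∂_r` and `∂_z`, diagonalises `i∂_φ - ω` and does not increase the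
form, while multiplication by the normalised angular mode goes back and preserves it.
-/

noncomputable section

namespace ConicalLayer

/-! ### Hardy's inequality -/

section IntegrationByParts

variable {E F G W : Type*} [NormedAddCommGroup E] [NormedSpace ℝ E]
  [NormedAddCommGroup F] [NormedSpace ℝ F] [NormedAddCommGroup G] [NormedSpace ℝ G]
  [NormedAddCommGroup W] [NormedSpace ℝ W]

theorem contDiff_smul_of_contDiffAt_tsupport {n : WithTop ℕ∞} {h : E → ℝ} {φ : E → F}
    (hφ : ContDiff ℝ n φ) (hh : ∀ x ∈ tsupport φ, ContDiffAt ℝ n h x) :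
    ContDiff ℝ n (fun x => h x • φ x) :=
  contMDiff_iff_contDiff.1 <| contMDiff_of_tsupport fun x hx =>
    ((hh x (tsupport_smul_subset_right h φ hx)).smul hφ.contDiffAt).contMDiffAt

theorem integrable_bilinear_of_hasCompactSupport {X : Type*} [TopologicalSpace X]
    [MeasurableSpace X] [OpensMeasurableSpace X] {μ : Measure X} [IsFiniteMeasureOnCompacts μ]
    {f : X → F} {g : X → G} (B : F →L[ℝ] G →L[ℝ] W) (hf : Continuous f) (hg : Continuous g)
    (hc : HasCompactSupport f) :
    Integrable (fun x => B (f x) (g x)) μ :=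
  ((B.continuous.comp hf).clm_apply hg).integrable_of_hasCompactSupport <|
    hc.mono fun x hx hfx => hx (by simp [hfx])

theorem integral_bilinear_fderiv_eq_neg_of_hasCompactSupport [FiniteDimensional ℝ E]
    [MeasurableSpace E] [BorelSpace E] {μ : Measure E} [μ.IsAddHaarMeasure] {f : E → F}
    {g : E → G} (B : F →L[ℝ] G →L[ℝ] W) (hf : ContDiff ℝ 1 f) (hg : ContDiff ℝ 1 g)
    (hc : HasCompactSupport f) (v : E) :
    ∫ x, B (f x) (fderiv ℝ g x v) ∂μ = -∫ x, B (fderiv ℝ f x v) (g x) ∂μ :=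
  integral_bilinear_fderiv_right_eq_neg_left_of_integrable
    (integrable_bilinear_of_hasCompactSupport B
      ((hf.continuous_fderiv one_ne_zero).clm_apply continuous_const) hg.continuous
      (hc.fderiv_apply ℝ v))
    (integrable_bilinear_of_hasCompactSupport B hf.continuous
      ((hg.continuous_fderiv one_ne_zero).clm_apply continuous_const) hc)
    (integrable_bilinear_of_hasCompactSupport B hf.continuous hg.continuous hc)
    (fun x _ => hf.differentiable one_ne_zero x) fun x _ => hg.differentiable one_ne_zero x

theorem norm_inv_smul_sq (r : ℝ) (z : F) : ‖r⁻¹ • z‖ ^ 2 = ‖z‖ ^ 2 / r ^ 2 := by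
  rw [norm_smul, mul_pow, norm_inv, inv_pow, Real.norm_eq_abs, sq_abs, inv_mul_eq_div]

end IntegrationByParts

section Hardy

variable {E F : Type*} [NormedAddCommGroup E] [NormedSpace ℝ E]
  [NormedAddCommGroup F] [InnerProductSpace ℝ F] {ℓ : E →L[ℝ] ℝ} {v : E} {φ : E → F}

theorem fderiv_inv_clm_smul {x : E} (hφ : DifferentiableAt ℝ φ x) (hx : ℓ x ≠ 0) (v : E) :
    fderiv ℝ (fun y => (ℓ y)⁻¹ • φ y) x v =
      (ℓ x)⁻¹ • fderiv ℝ φ x v - (ℓ v / ℓ x ^ 2) • φ x := by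
  have hinv : HasFDerivAt (fun y => (ℓ y)⁻¹) (-(ℓ x ^ 2)⁻¹ • ℓ) x :=
    (hasDerivAt_inv hx).comp_hasFDerivAt x ℓ.hasFDerivAt
  rw [(hinv.fun_smul hφ.hasFDerivAt).fderiv]
  simp [sub_eq_add_neg, div_eq_inv_mul]

variable [FiniteDimensional ℝ E] [MeasurableSpace E] [BorelSpace E] {μ : Measure E}
  [μ.IsAddHaarMeasure]

/-- Integration by parts of `φ` against `φ / ℓ`. -/
theorem integral_norm_inv_smul_sq_eq (hφ : ContDiff ℝ 1 φ) (hc : HasCompactSupport φ)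
    (hℓ : ∀ x ∈ tsupport φ, ℓ x ≠ 0) (hv : ℓ v = 1) :
    ∫ x, ‖(ℓ x)⁻¹ • φ x‖ ^ 2 ∂μ =
      2 * ∫ x, inner ℝ ((ℓ x)⁻¹ • φ x) (fderiv ℝ φ x v) ∂μ := by
  have hψ : ContDiff ℝ 1 fun x => (ℓ x)⁻¹ • φ x :=
    contDiff_smul_of_contDiffAt_tsupport hφ fun x hx => ℓ.contDiff.contDiffAt.inv (hℓ x hx)
  have hcψ : HasCompactSupport fun x => (ℓ x)⁻¹ • φ x := hc.smul_left
  have hint : Integrable (fun x => inner ℝ ((ℓ x)⁻¹ • φ x) (fderiv ℝ φ x v)) μ :=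
    integrable_bilinear_of_hasCompactSupport (innerSL ℝ) hψ.continuous
      ((hφ.continuous_fderiv one_ne_zero).clm_apply continuous_const) hcψ
  have hsq : Integrable (fun x => ‖(ℓ x)⁻¹ • φ x‖ ^ 2) μ :=
    (hψ.continuous.memLp_of_hasCompactSupport (p := 2) hcψ).integrable_norm_pow two_ne_zero
  have hDψ : ∀ x, inner ℝ (φ x) (fderiv ℝ (fun x => (ℓ x)⁻¹ • φ x) x v) =
      inner ℝ ((ℓ x)⁻¹ • φ x) (fderiv ℝ φ x v) - ‖(ℓ x)⁻¹ • φ x‖ ^ 2 := fun x => by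
    by_cases hx : x ∈ tsupport φ
    · rw [fderiv_inv_clm_smul (hφ.differentiable one_ne_zero x) (hℓ x hx), hv, inner_sub_right,
        real_inner_smul_right, real_inner_smul_right, real_inner_smul_left,
        real_inner_self_eq_norm_sq, norm_inv_smul_sq, one_div_mul_eq_div]
    · simp [image_eq_zero_of_notMem_tsupport hx]
  have hparts : ∫ x, inner ℝ (φ x) (fderiv ℝ (fun x => (ℓ x)⁻¹ • φ x) x v) ∂μ =
      -∫ x, inner ℝ (fderiv ℝ φ x v) ((ℓ x)⁻¹ • φ x) ∂μ :=
    integral_bilinear_fderiv_eq_neg_of_hasCompactSupport (innerSL ℝ) hφ hψ hc v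
  simp only [hDψ] at hparts
  rw [integral_sub hint hsq] at hparts
  have hcomm : ∫ x, inner ℝ (fderiv ℝ φ x v) ((ℓ x)⁻¹ • φ x) ∂μ =
      ∫ x, inner ℝ ((ℓ x)⁻¹ • φ x) (fderiv ℝ φ x v) ∂μ :=
    integral_congr_ae (.of_forall fun x => real_inner_comm _ _)
  linarith

theorem integral_norm_fderiv_sub_sq_eq (hφ : ContDiff ℝ 1 φ) (hc : HasCompactSupport φ)
    (hℓ : ∀ x ∈ tsupport φ, ℓ x ≠ 0) (hv : ℓ v = 1) :
    ∫ x, ‖fderiv ℝ φ x v - (2⁻¹ : ℝ) • (ℓ x)⁻¹ • φ x‖ ^ 2 ∂μ =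
      ∫ x, ‖fderiv ℝ φ x v‖ ^ 2 ∂μ - 1 / 4 * ∫ x, ‖(ℓ x)⁻¹ • φ x‖ ^ 2 ∂μ := by
  have hψ : Continuous fun x => (ℓ x)⁻¹ • φ x :=
    (contDiff_smul_of_contDiffAt_tsupport hφ fun x hx =>
      ℓ.contDiff.contDiffAt.inv (hℓ x hx)).continuous
  have hcψ : HasCompactSupport fun x => (ℓ x)⁻¹ • φ x := hc.smul_left
  have hDφ : Continuous fun x => fderiv ℝ φ x v :=
    (hφ.continuous_fderiv one_ne_zero).clm_apply continuous_const
  have hDsq : Integrable (fun x => ‖fderiv ℝ φ x v‖ ^ 2) μ :=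
    (hDφ.memLp_of_hasCompactSupport (p := 2) (hc.fderiv_apply ℝ v)).integrable_norm_pow two_ne_zero
  have hsq : Integrable (fun x => ‖(ℓ x)⁻¹ • φ x‖ ^ 2) μ :=
    (hψ.memLp_of_hasCompactSupport (p := 2) hcψ).integrable_norm_pow two_ne_zero
  have hint : Integrable (fun x => inner ℝ ((ℓ x)⁻¹ • φ x) (fderiv ℝ φ x v)) μ :=
    integrable_bilinear_of_hasCompactSupport (innerSL ℝ) hψ hDφ hcψ
  have hexpand : ∀ x, ‖fderiv ℝ φ x v - (2⁻¹ : ℝ) • (ℓ x)⁻¹ • φ x‖ ^ 2 =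
      ‖fderiv ℝ φ x v‖ ^ 2 - inner ℝ ((ℓ x)⁻¹ • φ x) (fderiv ℝ φ x v)
        + 1 / 4 * ‖(ℓ x)⁻¹ • φ x‖ ^ 2 := fun x => by
    rw [norm_sub_sq_real, real_inner_smul_right, norm_smul, real_inner_comm, Real.norm_eq_abs,
      abs_of_pos (by norm_num)]
    ring
  simp only [hexpand]
  rw [integral_add (by exact hDsq.sub hint) (hsq.const_mul _), integral_sub hDsq hint,
    integral_const_mul, integral_norm_inv_smul_sq_eq hφ hc hℓ hv]
  ring

theorem integral_norm_inv_smul_sq_le_four_mul (hφ : ContDiff ℝ 1 φ) (hc : HasCompactSupport φ)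
    (hℓ : ∀ x ∈ tsupport φ, ℓ x ≠ 0) (hv : ℓ v = 1) :
    ∫ x, ‖(ℓ x)⁻¹ • φ x‖ ^ 2 ∂μ ≤ 4 * ∫ x, ‖fderiv ℝ φ x v‖ ^ 2 ∂μ := by
  have hsq := integral_norm_fderiv_sub_sq_eq (μ := μ) hφ hc hℓ hv
  have hnonneg : 0 ≤ ∫ x, ‖fderiv ℝ φ x v - (2⁻¹ : ℝ) • (ℓ x)⁻¹ • φ x‖ ^ 2 ∂μ :=
    integral_nonneg fun x => sq_nonneg _
  linarith

end Hardy

/-! ### Parametric integrals -/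

section ParametricIntegral

universe u

variable {E F : Type u} [NormedAddCommGroup E] [NormedSpace ℝ E] [NormedAddCommGroup F]
  [NormedSpace ℝ F]

theorem hasFDerivAt_comp_prodMk_left {f : E × ℝ → F} {x : E} {t : ℝ}
    (hf : DifferentiableAt ℝ f (x, t)) :
    HasFDerivAt (fun y => f (y, t))
      ((fderiv ℝ f (x, t)).comp (ContinuousLinearMap.inl ℝ E ℝ)) x :=
  HasFDerivAt.comp (g := f) (f := fun y => (y, t)) x hf.hasFDerivAt (hasFDerivAt_prodMk_left x t)

variable [LocallyCompactSpace E]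

theorem hasFDerivAt_intervalIntegral_of_contDiff {f : E × ℝ → F} (hf : ContDiff ℝ 1 f)
    (a b : ℝ) (x : E) :
    HasFDerivAt (fun x => ∫ t in a..b, f (x, t))
      (∫ t in a..b, (fderiv ℝ f (x, t)).comp (ContinuousLinearMap.inl ℝ E ℝ)) x := by
  have hcont : Continuous fun y : E × ℝ =>
      (fderiv ℝ f y).comp (ContinuousLinearMap.inl ℝ E ℝ) :=
    (hf.continuous_fderiv one_ne_zero).clm_comp continuous_const
  obtain ⟨K, hK, hxK⟩ := exists_compact_mem_nhds x
  obtain ⟨C, hC⟩ := (hK.prod (isCompact_uIcc (a := a) (b := b))).bddAbove_image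
    hcont.norm.continuousOn
  refine intervalIntegral.hasFDerivAt_integral_of_dominated_of_fderiv_le
    (F' := fun y t => (fderiv ℝ f (y, t)).comp (ContinuousLinearMap.inl ℝ E ℝ))
    (bound := fun _ => C) hxK ?_ ?_ ?_ ?_ intervalIntegrable_const ?_
  · exact .of_forall fun y => (hf.continuous.comp (by fun_prop)).aestronglyMeasurable
  · exact (hf.continuous.comp (by fun_prop)).intervalIntegrable _ _
  · exact (hcont.comp (by fun_prop : Continuous fun t : ℝ => (x, t))).aestronglyMeasurable
  · exact .of_forall fun t ht y hy => hC ⟨(y, t), ⟨hy, Set.uIoc_subset_uIcc ht⟩, rfl⟩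
  · exact .of_forall fun t _ y _ => hasFDerivAt_comp_prodMk_left
      (hf.differentiable one_ne_zero (y, t))

theorem contDiff_intervalIntegral_nat {f : E × ℝ → F} {n : ℕ} (hf : ContDiff ℝ (n + 1) f)
    (a b : ℝ) : ContDiff ℝ n fun x => ∫ t in a..b, f (x, t) := by
  induction n generalizing F with
  | zero =>
    exact contDiff_zero.2 <| continuous_iff_continuousAt.2 fun x =>
      (hasFDerivAt_intervalIntegral_of_contDiff (hf.of_le (by simp)) a b x).continuousAt
  | succ n ih =>
    have hD := hasFDerivAt_intervalIntegral_of_contDiff (hf.of_le (by simp)) a b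
    push_cast at hf ⊢
    refine contDiff_succ_iff_fderiv.2 ⟨fun x => (hD x).differentiableAt, by simp, ?_⟩
    rw [funext fun x => (hD x).fderiv]
    exact ih ((hf.fderiv_right le_rfl).clm_comp contDiff_const)

theorem contDiff_intervalIntegral {f : E × ℝ → F} (hf : ContDiff ℝ (⊤ : ℕ∞) f) (a b : ℝ) :
    ContDiff ℝ (⊤ : ℕ∞) fun x => ∫ t in a..b, f (x, t) :=
  contDiff_infty.2 fun n => contDiff_intervalIntegral_nat (hf.of_le (by exact_mod_cast le_top)) a b

end ParametricIntegral

/-! ### Closures of forms in `L²` -/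

section L2

variable {α β F : Type*} [MeasurableSpace α] [MeasurableSpace β] {μ : Measure α} {ν : Measure β}
  [NormedAddCommGroup F]

theorem eLpNorm_two_sq (f : α → F) (μ : Measure α) :
    eLpNorm f 2 μ ^ 2 = ∫⁻ x, ‖f x‖ₑ ^ 2 ∂μ := by
  have h := eLpNorm_nnreal_pow_eq_lintegral (μ := μ) (f := f) (p := 2) two_ne_zero
  simpa using h

theorem ofReal_integral_norm_sq {f : α → F} (hf : MemLp f 2 μ) :
    ENNReal.ofReal (∫ x, ‖f x‖ ^ 2 ∂μ) = eLpNorm f 2 μ ^ 2 := by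
  rw [ofReal_integral_eq_lintegral_ofReal (hf.integrable_norm_pow two_ne_zero)
    (.of_forall fun x => sq_nonneg _), eLpNorm_two_sq]
  simp [ENNReal.ofReal_pow]

theorem norm_sq_eq_integral (u : Lp F 2 μ) : ‖u‖ ^ 2 = ∫ x, ‖u x‖ ^ 2 ∂μ := by
  rw [Lp.norm_def, ← ENNReal.toReal_pow, ← ofReal_integral_norm_sq (Lp.memLp u),
    ENNReal.toReal_ofReal (integral_nonneg fun x => sq_nonneg _)]

theorem norm_toLp_sq {f : α → F} (hf : MemLp f 2 μ) :
    ‖hf.toLp f‖ ^ 2 = ∫ x, ‖f x‖ ^ 2 ∂μ := by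
  rw [norm_sq_eq_integral]
  exact integral_congr_ae (hf.coeFn_toLp.mono fun x hx => by simp only [hx])

theorem cauchySeq_iff_tendsto_norm_sub_sq {E : Type*} [SeminormedAddCommGroup E] {x : ℕ → E} :
    CauchySeq x ↔ Tendsto (fun k : ℕ × ℕ => ‖x k.1 - x k.2‖ ^ 2) atTop (𝓝 0) := by
  simp only [cauchySeq_iff_tendsto_dist_atTop_0, dist_eq_norm]
  exact ⟨fun h => by simpa using h.pow 2, fun h => by simpa using h.sqrt⟩

/-- The domain of the closure of the form `Q` on the core `T ⊆ L²(μ)`: the `L²`-limits of sequences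
in `T` that are Cauchy for `Q`. -/
def formDomain (μ : Measure α) (T : (α → ℂ) → Prop) (Q : (α → ℂ) → ℝ) : Set (Lp ℂ 2 μ) :=
  {u | ∃ v : ℕ → α → ℂ, (∀ n, T (v n)) ∧
    Tendsto (fun n => eLpNorm (fun x => v n x - u x) 2 μ) atTop (𝓝 0) ∧
    Tendsto (fun k : ℕ × ℕ => Q (fun x => v k.1 x - v k.2 x)) atTop (𝓝 0)}

theorem mem_formDomain_of_map {T : (α → ℂ) → Prop} {T' : (β → ℂ) → Prop} {Q : (α → ℂ) → ℝ}
    {Q' : (β → ℂ) → ℝ} {u : Lp ℂ 2 μ} {u' : Lp ℂ 2 ν} (P : (α → ℂ) → β → ℂ) (C : ℝ)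
    (hu : u ∈ formDomain μ T Q) (hT : ∀ v, T v → T' (P v))
    (hnorm : ∀ v, T v →
      eLpNorm (fun y => P v y - u' y) 2 ν ≤ eLpNorm (fun x => v x - u x) 2 μ)
    (hnonneg : ∀ v, 0 ≤ Q' v)
    (hQ : ∀ v w, T v → T w → Q' (fun y => P v y - P w y) ≤ C * Q (fun x => v x - w x)) :
    u' ∈ formDomain ν T' Q' := by
  obtain ⟨v, hv, hlim, hcauchy⟩ := hu
  refine ⟨fun n => P (v n), fun n => hT _ (hv n), ?_, ?_⟩
  · exact tendsto_of_tendsto_of_tendsto_of_le_of_le tendsto_const_nhds hlim (fun _ => zero_le)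
      fun n => hnorm _ (hv n)
  · exact squeeze_zero (fun _ => hnonneg _) (fun k => hQ _ _ (hv k.1) (hv k.2))
      (by simpa using hcauchy.const_mul C)

end L2

/-! ### Test functions and weak derivatives on the guide -/

section WeakDerivatives

theorem isOpen_Gui (θ : ℝ) : IsOpen (Gui θ) := by
  simp only [Gui, Set.ofPred_and]
  refine .inter ?_ (.inter ?_ (.inter ?_ ?_)) <;> exact isOpen_lt (by fun_prop) (by fun_prop)

instance isLocallyFiniteMeasure_flatMeasure (θ : ℝ) :
    IsLocallyFiniteMeasure (flatMeasure θ) := by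
  unfold flatMeasure; infer_instance

theorem ae_mem_Gui (θ : ℝ) : ∀ᵐ p ∂flatMeasure θ, p ∈ Gui θ :=
  ae_restrict_mem (isOpen_Gui θ).measurableSet

theorem ae_fst_pos (θ : ℝ) : ∀ᵐ p ∂flatMeasure θ, 0 < p.1 :=
  (ae_mem_Gui θ).mono fun _ hp => hp.1

variable {θ : ℝ} {φ ψ : ℝ × ℝ → ℂ} {e : ℝ × ℝ} {u u' v g g' : L2Flat θ}

namespace IsGuiTest

theorem eq_zero_of_notMem (hφ : IsGuiTest θ φ) {p : ℝ × ℝ} (hp : p ∉ Gui θ) : φ p = 0 :=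
  image_eq_zero_of_notMem_tsupport fun h => hp (hφ.support h)

theorem contDiff_one (hφ : IsGuiTest θ φ) : ContDiff ℝ 1 φ :=
  hφ.smooth.of_le (by simp)

theorem differentiable (hφ : IsGuiTest θ φ) : Differentiable ℝ φ :=
  hφ.contDiff_one.differentiable one_ne_zero

theorem memLp (hφ : IsGuiTest θ φ) : MemLp φ 2 (flatMeasure θ) :=
  hφ.smooth.continuous.memLp_of_hasCompactSupport hφ.compact

theorem sub (hφ : IsGuiTest θ φ) (hψ : IsGuiTest θ ψ) : IsGuiTest θ (φ - ψ) where
  smooth := hφ.smooth.sub hψ.smooth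
  compact := hφ.compact.sub hψ.compact
  support := (tsupport_sub φ ψ).trans (Set.union_subset hφ.support hψ.support)

theorem fderiv_apply (hφ : IsGuiTest θ φ) (e : ℝ × ℝ) :
    IsGuiTest θ (fun p => fderiv ℝ φ p e) where
  smooth := (hφ.smooth.fderiv_right (by simp)).clm_apply contDiff_const
  compact := hφ.compact.fderiv_apply ℝ e
  support := (tsupport_fderiv_apply_subset ℝ e).trans hφ.support

theorem smul_left {h : ℝ × ℝ → ℝ} (hφ : IsGuiTest θ φ)
    (hh : ∀ p : ℝ × ℝ, 0 < p.1 → ContDiffAt ℝ (⊤ : ℕ∞) h p) :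
    IsGuiTest θ (fun p => h p • φ p) where
  smooth := contDiff_smul_of_contDiffAt_tsupport hφ.smooth fun p hp => hh p (hφ.support hp).1
  compact := hφ.compact.smul_left (f := h)
  support := (tsupport_smul_subset_right h φ).trans hφ.support

theorem inv_fst_smul (hφ : IsGuiTest θ φ) : IsGuiTest θ (fun p => p.1⁻¹ • φ p) :=
  hφ.smul_left fun _ hp => contDiffAt_fst.inv hp.ne'

theorem setIntegral_norm_sq (hφ : IsGuiTest θ φ) :
    ∫ p, ‖φ p‖ ^ 2 ∂flatMeasure θ = ∫ p, ‖φ p‖ ^ 2 :=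
  setIntegral_eq_integral_of_forall_compl_eq_zero fun p hp => by simp [hφ.eq_zero_of_notMem hp]

theorem integral_norm_inv_fst_smul_sq_le (hφ : IsGuiTest θ φ) :
    ∫ p, ‖p.1⁻¹ • φ p‖ ^ 2 ∂flatMeasure θ ≤
      4 * ∫ p, ‖fderiv ℝ φ p (1, 0)‖ ^ 2 ∂flatMeasure θ := by
  rw [hφ.inv_fst_smul.setIntegral_norm_sq, (hφ.fderiv_apply _).setIntegral_norm_sq]
  exact integral_norm_inv_smul_sq_le_four_mul (ℓ := ContinuousLinearMap.fst ℝ ℝ ℝ)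
    hφ.contDiff_one hφ.compact (fun p hp => (hφ.support hp).1.ne') rfl

theorem integral_norm_fderiv_sub_inv_fst_smul_sq (hφ : IsGuiTest θ φ) :
    ∫ p, ‖fderiv ℝ φ p (1, 0) - (2⁻¹ : ℝ) • p.1⁻¹ • φ p‖ ^ 2 ∂flatMeasure θ =
      ∫ p, ‖fderiv ℝ φ p (1, 0)‖ ^ 2 ∂flatMeasure θ
        - 1 / 4 * ∫ p, ‖p.1⁻¹ • φ p‖ ^ 2 ∂flatMeasure θ := by
  have hgs : IsGuiTest θ fun p => fderiv ℝ φ p (1, 0) - (2⁻¹ : ℝ) • p.1⁻¹ • φ p :=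
    (hφ.fderiv_apply _).sub (hφ.inv_fst_smul.smul_left fun _ _ => contDiffAt_const)
  rw [hgs.setIntegral_norm_sq, hφ.inv_fst_smul.setIntegral_norm_sq,
    (hφ.fderiv_apply _).setIntegral_norm_sq]
  exact integral_norm_fderiv_sub_sq_eq (ℓ := ContinuousLinearMap.fst ℝ ℝ ℝ)
    hφ.contDiff_one hφ.compact (fun p hp => (hφ.support hp).1.ne') rfl

theorem toLp_mem_testClasses (hφ : IsGuiTest θ φ) : hφ.memLp.toLp φ ∈ testClasses θ :=
  ⟨φ, hφ, hφ.memLp.coeFn_toLp⟩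

end IsGuiTest

theorem mem_testClasses_iff {u : L2Flat θ} :
    u ∈ testClasses θ ↔ ∃ φ, ∃ hφ : IsGuiTest θ φ, hφ.memLp.toLp φ = u :=
  ⟨fun ⟨φ, hφ, h⟩ => ⟨φ, hφ, Lp.ext (hφ.memLp.coeFn_toLp.trans h.symm)⟩,
    fun ⟨_, hφ, h⟩ => h ▸ hφ.toLp_mem_testClasses⟩

/-- The complex bilinear pairing `(u, w) ↦ ∫ u w` on `L²(Gui(θ))`. -/
def flatPairing (θ : ℝ) : L2Flat θ →L[ℝ] L2Flat θ →L[ℝ] ℂ :=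
  (ContinuousLinearMap.mul ℝ ℂ).lpPairing (flatMeasure θ) 2 2

theorem flatPairing_toLp (u : L2Flat θ) (hφ : IsGuiTest θ φ) :
    flatPairing θ u (hφ.memLp.toLp φ) = ∫ p, u p * φ p ∂flatMeasure θ := by
  rw [flatPairing, ContinuousLinearMap.lpPairing_eq_integral]
  exact integral_congr_ae (hφ.memLp.coeFn_toLp.mono fun p hp => by simp [hp])

theorem isWeakPartial_iff_flatPairing :
    IsWeakPartial θ e u g ↔ ∀ φ, ∀ hφ : IsGuiTest θ φ,
      flatPairing θ u ((hφ.fderiv_apply e).memLp.toLp _) =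
        -flatPairing θ g (hφ.memLp.toLp φ) :=
  forall₂_congr fun φ hφ => by
    rw [flatPairing_toLp u (hφ.fderiv_apply e), flatPairing_toLp g hφ]

theorem IsWeakPartial.sub (h : IsWeakPartial θ e u g) (h' : IsWeakPartial θ e u' g') :
    IsWeakPartial θ e (u - u') (g - g') :=
  isWeakPartial_iff_flatPairing.2 fun φ hφ => by
    simp only [map_sub, sub_apply,
      isWeakPartial_iff_flatPairing.1 h φ hφ, isWeakPartial_iff_flatPairing.1 h' φ hφ]
    ring

theorem isWeakPartial_of_tendsto {un gn : ℕ → L2Flat θ}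
    (h : ∀ n, IsWeakPartial θ e (un n) (gn n)) (hu : Tendsto un atTop (𝓝 u))
    (hg : Tendsto gn atTop (𝓝 g)) : IsWeakPartial θ e u g :=
  isWeakPartial_iff_flatPairing.2 fun φ hφ => by
    have hlim := fun {w : ℕ → L2Flat θ} {v} (hw : Tendsto w atTop (𝓝 v)) (f : L2Flat θ) =>
      (((flatPairing θ).flip f).continuous.tendsto v).comp hw
    refine tendsto_nhds_unique (hlim hu _) ((hlim hg (hφ.memLp.toLp φ)).neg.congr fun n => ?_)
    exact (isWeakPartial_iff_flatPairing.1 (h n) φ hφ).symm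

theorem IsWeakPartial.eq_zero (h : IsWeakPartial θ e 0 g) : g = 0 := by
  have hloc : LocallyIntegrable g (flatMeasure θ) :=
    (Lp.memLp g).locallyIntegrable one_le_two
  have hzero := (isOpen_Gui θ).ae_eq_zero_of_integral_contDiff_smul_eq_zero
    (μ := flatMeasure θ) (hloc.locallyIntegrableOn _) fun f hf hc hs => by
      have hφ : IsGuiTest θ (fun p => (f p : ℂ)) :=
        ⟨Complex.ofRealCLM.contDiff.comp hf, hc.comp_left Complex.ofReal_zero,
          (tsupport_comp_subset Complex.ofReal_zero f).trans hs⟩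
      have hpair := isWeakPartial_iff_flatPairing.1 h _ hφ
      rw [map_zero, zero_apply, zero_eq_neg, flatPairing_toLp g hφ] at hpair
      simpa only [Complex.real_smul, mul_comm] using hpair
  refine Lp.ext ?_
  filter_upwards [hzero, ae_mem_Gui θ, Lp.coeFn_zero ℂ 2 (flatMeasure θ)] with p hp hG h0
  rw [hp hG, h0, Pi.zero_apply]

theorem IsWeakPartial.weakPartial_eq (h : IsWeakPartial θ e u g) : weakPartial θ e u = g := by
  have hex : ∃ g, IsWeakPartial θ e u g := ⟨g, h⟩
  rw [weakPartial, dif_pos hex, ← sub_eq_zero]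
  have hsub := hex.choose_spec.sub h
  rw [sub_self] at hsub
  exact hsub.eq_zero

theorem isWeakPartial_weakPartial (h : ∃ g, IsWeakPartial θ e u g) :
    IsWeakPartial θ e u (weakPartial θ e u) := by
  obtain ⟨g, hg⟩ := h
  rwa [hg.weakPartial_eq]

theorem IsGuiTest.isWeakPartial (hφ : IsGuiTest θ φ) (e : ℝ × ℝ) :
    IsWeakPartial θ e (hφ.memLp.toLp φ) ((hφ.fderiv_apply e).memLp.toLp _) := by
  intro ψ hψ
  calc ∫ p, hφ.memLp.toLp φ p * fderiv ℝ ψ p e ∂flatMeasure θ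
      = ∫ p, φ p * fderiv ℝ ψ p e ∂flatMeasure θ :=
        integral_congr_ae (hφ.memLp.coeFn_toLp.mono fun p hp => by simp only [hp])
    _ = ∫ p, φ p * fderiv ℝ ψ p e :=
        setIntegral_eq_integral_of_forall_compl_eq_zero fun p hp => by
          simp [hφ.eq_zero_of_notMem hp]
    _ = -∫ p, fderiv ℝ φ p e * ψ p :=
        integral_bilinear_fderiv_eq_neg_of_hasCompactSupport (ContinuousLinearMap.mul ℝ ℂ)
          hφ.contDiff_one hψ.contDiff_one hφ.compact e
    _ = -∫ p, fderiv ℝ φ p e * ψ p ∂flatMeasure θ := by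
        rw [eq_comm, neg_inj]
        exact setIntegral_eq_integral_of_forall_compl_eq_zero fun p hp => by
          simp [hψ.eq_zero_of_notMem hp]
    _ = -∫ p, (hφ.fderiv_apply e).memLp.toLp _ p * ψ p ∂flatMeasure θ :=
        congrArg _ <| integral_congr_ae <|
          (hφ.fderiv_apply e).memLp.coeFn_toLp.mono fun p hp => by simp only [hp]

theorem weakPartial_sub (hu : ∃ g, IsWeakPartial θ e u g) (hv : ∃ g, IsWeakPartial θ e v g) :
    weakPartial θ e (u - v) = weakPartial θ e u - weakPartial θ e v :=
  ((isWeakPartial_weakPartial hu).sub (isWeakPartial_weakPartial hv)).weakPartial_eq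

theorem IsGuiTest.weakPartial_toLp (hφ : IsGuiTest θ φ) (e : ℝ × ℝ) :
    weakPartial θ e (hφ.memLp.toLp φ) = (hφ.fderiv_apply e).memLp.toLp _ :=
  (hφ.isWeakPartial e).weakPartial_eq

theorem IsGuiTest.toLp_mem_H1 (hφ : IsGuiTest θ φ) : hφ.memLp.toLp φ ∈ H1 θ :=
  ⟨⟨_, hφ.isWeakPartial _⟩, ⟨_, hφ.isWeakPartial _⟩⟩

theorem tendsto_h1Norm_zero_iff {u : ℕ → L2Flat θ} :
    Tendsto (fun n => h1Norm θ (u n)) atTop (𝓝 0) ↔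
      Tendsto u atTop (𝓝 0) ∧
      Tendsto (fun n => weakPartial θ (1, 0) (u n)) atTop (𝓝 0) ∧
      Tendsto (fun n => weakPartial θ (0, 1) (u n)) atTop (𝓝 0) := by
  refine ⟨fun h => ?_, fun ⟨h, hr, hz⟩ => ?_⟩
  · refine ⟨squeeze_zero_norm (fun n => ?_) h, squeeze_zero_norm (fun n => ?_) h,
      squeeze_zero_norm (fun n => ?_) h⟩ <;>
    · apply Real.le_sqrt_of_sq_le
      linarith [sq_nonneg ‖u n‖, sq_nonneg ‖weakPartial θ (1, 0) (u n)‖,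
        sq_nonneg ‖weakPartial θ (0, 1) (u n)‖]
  · simpa [h1Norm] using (((h.norm.pow 2).add (hr.norm.pow 2)).add (hz.norm.pow 2)).sqrt

theorem mem_H10_iff :
    u ∈ H10 θ ↔ ∃ (φ : ℕ → ℝ × ℝ → ℂ) (hφ : ∀ n, IsGuiTest θ (φ n)),
      Tendsto (fun n => (hφ n).memLp.toLp (φ n)) atTop (𝓝 u) ∧
      (∃ g, Tendsto (fun n => ((hφ n).fderiv_apply (1, 0)).memLp.toLp _) atTop (𝓝 g)) ∧
      ∃ g, Tendsto (fun n => ((hφ n).fderiv_apply (0, 1)).memLp.toLp _) atTop (𝓝 g) := by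
  have hlim {φ : ℕ → ℝ × ℝ → ℂ} (hφ : ∀ n, IsGuiTest θ (φ n)) (hu : u ∈ H1 θ) :
      Tendsto (fun n => h1Norm θ ((hφ n).memLp.toLp _ - u)) atTop (𝓝 0) ↔
        Tendsto (fun n => (hφ n).memLp.toLp _) atTop (𝓝 u) ∧
        Tendsto (fun n => ((hφ n).fderiv_apply (1, 0)).memLp.toLp _) atTop
          (𝓝 (weakPartial θ (1, 0) u)) ∧
        Tendsto (fun n => ((hφ n).fderiv_apply (0, 1)).memLp.toLp _) atTop
          (𝓝 (weakPartial θ (0, 1) u)) := by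
    simp only [tendsto_h1Norm_zero_iff, weakPartial_sub (hφ _).toLp_mem_H1.1 hu.1,
      weakPartial_sub (hφ _).toLp_mem_H1.2 hu.2, IsGuiTest.weakPartial_toLp (hφ _),
      tendsto_sub_nhds_zero_iff]
  constructor
  · rintro ⟨hu, w, hw, hconv⟩
    choose φ hφ hφw using fun n => mem_testClasses_iff.1 (hw n)
    simp only [← hφw] at hconv
    obtain ⟨h, hr, hz⟩ := (hlim hφ hu).1 hconv
    exact ⟨φ, hφ, h, ⟨_, hr⟩, ⟨_, hz⟩⟩
  · rintro ⟨φ, hφ, h, ⟨gr, hr⟩, ⟨gz, hz⟩⟩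
    have hwr := isWeakPartial_of_tendsto (fun n => (hφ n).isWeakPartial (1, 0)) h hr
    have hwz := isWeakPartial_of_tendsto (fun n => (hφ n).isWeakPartial (0, 1)) h hz
    have hu : u ∈ H1 θ := ⟨⟨gr, hwr⟩, ⟨gz, hwz⟩⟩
    refine ⟨hu, _, fun n => (hφ n).toLp_mem_testClasses, (hlim hφ hu).2 ⟨h, ?_, ?_⟩⟩
    · rwa [hwr.weakPartial_eq]
    · rwa [hwz.weakPartial_eq]

theorem testClasses_subset_H10 (θ : ℝ) : testClasses θ ⊆ H10 θ := by
  intro u hu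
  obtain ⟨φ, hφ, rfl⟩ := mem_testClasses_iff.1 hu
  exact mem_H10_iff.2 ⟨fun _ => φ, fun _ => hφ, tendsto_const_nhds, ⟨_, tendsto_const_nhds⟩,
    ⟨_, tendsto_const_nhds⟩⟩

theorem IsGuiTest.toLp_fderiv_sub (hφ : IsGuiTest θ φ) (hψ : IsGuiTest θ ψ) (e : ℝ × ℝ) :
    ((hφ.sub hψ).fderiv_apply e).memLp.toLp _ =
      (hφ.fderiv_apply e).memLp.toLp _ - (hψ.fderiv_apply e).memLp.toLp _ := by
  rw [← MemLp.toLp_sub]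
  refine MemLp.toLp_congr _ _ (.of_forall fun p => ?_)
  simp [fderiv_sub (hφ.differentiable p) (hψ.differentiable p)]

theorem sub_mem_H10 (hu : u ∈ H10 θ) (hv : v ∈ H10 θ) : u - v ∈ H10 θ := by
  obtain ⟨φ, hφ, hlimφ, ⟨gr, hrφ⟩, ⟨gz, hzφ⟩⟩ := mem_H10_iff.1 hu
  obtain ⟨ψ, hψ, hlimψ, ⟨kr, hrψ⟩, ⟨kz, hzψ⟩⟩ := mem_H10_iff.1 hv
  refine mem_H10_iff.2 ⟨_, fun n => (hφ n).sub (hψ n), ?_, ⟨gr - kr, ?_⟩, ⟨gz - kz, ?_⟩⟩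
  · exact (hlimφ.sub hlimψ).congr fun n => ((hφ n).memLp.toLp_sub (hψ n).memLp).symm
  · exact (hrφ.sub hrψ).congr fun n => ((hφ n).toLp_fderiv_sub (hψ n) _).symm
  · exact (hzφ.sub hzψ).congr fun n => ((hφ n).toLp_fderiv_sub (hψ n) _).symm

/-- The Dirichlet integral `∫ |∂_r φ|² + |∂_z φ|²` of a differentiable function on `Gui(θ)`. -/
def dirichletForm (θ : ℝ) (φ : ℝ × ℝ → ℂ) : ℝ :=
  ∫ p, ‖fderiv ℝ φ p (1, 0)‖ ^ 2 ∂flatMeasure θ + ∫ p, ‖fderiv ℝ φ p (0, 1)‖ ^ 2 ∂flatMeasure θ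

theorem IsGuiTest.dirichletForm_sub (hφ : IsGuiTest θ φ) (hψ : IsGuiTest θ ψ) :
    dirichletForm θ (φ - ψ) =
      ‖(hφ.fderiv_apply (1, 0)).memLp.toLp _ - (hψ.fderiv_apply (1, 0)).memLp.toLp _‖ ^ 2 +
      ‖(hφ.fderiv_apply (0, 1)).memLp.toLp _ - (hψ.fderiv_apply (0, 1)).memLp.toLp _‖ ^ 2 := by
  rw [dirichletForm, ← hφ.toLp_fderiv_sub hψ, ← hφ.toLp_fderiv_sub hψ, norm_toLp_sq,
    norm_toLp_sq]

theorem H10_eq_formDomain (θ : ℝ) :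
    H10 θ = formDomain (flatMeasure θ) (IsGuiTest θ) (dirichletForm θ) := by
  ext u
  rw [mem_H10_iff]
  refine exists_congr fun φ => ?_
  rw [← exists_prop]
  refine exists_congr fun hφ => and_congr ?_ ?_
  · have h := Lp.tendsto_Lp_iff_tendsto_eLpNorm'' φ (fun n => (hφ n).memLp) u (Lp.memLp u)
      (fi := atTop)
    rwa [Lp.toLp_coeFn] at h
  · have hform : ∀ k : ℕ × ℕ, dirichletForm θ (fun p => φ k.1 p - φ k.2 p) = _ :=
      fun k => (hφ k.1).dirichletForm_sub (hφ k.2)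
    simp only [hform]
    refine ⟨fun ⟨⟨_, hr⟩, ⟨_, hz⟩⟩ => ?_, fun h => ⟨?_, ?_⟩⟩
    · simpa using (cauchySeq_iff_tendsto_norm_sub_sq.1 hr.cauchySeq).add
        (cauchySeq_iff_tendsto_norm_sub_sq.1 hz.cauchySeq)
    · exact cauchySeq_tendsto_of_complete <| cauchySeq_iff_tendsto_norm_sub_sq.2 <|
        squeeze_zero (fun _ => sq_nonneg _) (fun _ => le_add_of_nonneg_right (sq_nonneg _)) h
    · exact cauchySeq_tendsto_of_complete <| cauchySeq_iff_tendsto_norm_sub_sq.2 <|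
        squeeze_zero (fun _ => sq_nonneg _) (fun _ => le_add_of_nonneg_left (sq_nonneg _)) h

end WeakDerivatives

/-! ### The flat form on `H₀¹` -/

section FlatForm

variable {θ : ℝ} {φ : ℝ × ℝ → ℂ} {u : L2Flat θ}

theorem IsGuiTest.eLpNorm_inv_fst_smul_le (hφ : IsGuiTest θ φ) :
    eLpNorm (fun p => p.1⁻¹ • φ p) 2 (flatMeasure θ) ≤
      2 * eLpNorm (fun p => fderiv ℝ φ p (1, 0)) 2 (flatMeasure θ) := by
  rw [← ENNReal.pow_le_pow_left_iff (n := 2) two_ne_zero, mul_pow,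
    ← ofReal_integral_norm_sq hφ.inv_fst_smul.memLp,
    ← ofReal_integral_norm_sq (hφ.fderiv_apply _).memLp]
  refine (ENNReal.ofReal_le_ofReal hφ.integral_norm_inv_fst_smul_sq_le).trans_eq ?_
  rw [ENNReal.ofReal_mul (by norm_num)]
  norm_num

theorem eLpNorm_inv_fst_smul_le (hu : u ∈ H10 θ) :
    eLpNorm (fun p => p.1⁻¹ • u p) 2 (flatMeasure θ) ≤
      2 * eLpNorm (weakPartial θ (1, 0) u) 2 (flatMeasure θ) := by
  obtain ⟨φ, hφ, hlim, ⟨g, hr⟩, -⟩ := mem_H10_iff.1 hu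
  rw [(isWeakPartial_of_tendsto (fun n => (hφ n).isWeakPartial _) hlim hr).weakPartial_eq]
  obtain ⟨k, hk, hae⟩ := (tendstoInMeasure_of_tendsto_Lp hlim).exists_seq_tendsto_ae
  have hae' : ∀ᵐ p ∂flatMeasure θ,
      Tendsto (fun n => p.1⁻¹ • φ (k n) p) atTop (𝓝 (p.1⁻¹ • u p)) := by
    filter_upwards [hae, ae_all_iff.2 fun n => (hφ (k n)).memLp.coeFn_toLp] with p hp hφp
    exact (hp.congr hφp).const_smul _
  have hnorm : Tendsto (fun n => eLpNorm (fun p => fderiv ℝ (φ (k n)) p (1, 0)) 2 (flatMeasure θ))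
      atTop (𝓝 (eLpNorm g 2 (flatMeasure θ))) := by
    simpa only [Function.comp_def, Lp.enorm_def, eLpNorm_congr_ae (MemLp.coeFn_toLp _)] using
      (hr.comp hk.tendsto_atTop).enorm
  calc eLpNorm (fun p => p.1⁻¹ • u p) 2 (flatMeasure θ)
      ≤ liminf (fun n => eLpNorm (fun p => p.1⁻¹ • φ (k n) p) 2 (flatMeasure θ)) atTop :=
        Lp.eLpNorm_lim_le_liminf_eLpNorm
          (fun n => (hφ (k n)).inv_fst_smul.memLp.aestronglyMeasurable) _ hae'
    _ ≤ liminf (fun n => 2 * eLpNorm (fun p => fderiv ℝ (φ (k n)) p (1, 0)) 2 (flatMeasure θ))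
          atTop := liminf_le_liminf (.of_forall fun n => (hφ (k n)).eLpNorm_inv_fst_smul_le)
    _ = 2 * eLpNorm g 2 (flatMeasure θ) :=
        (ENNReal.Tendsto.const_mul hnorm (.inr ENNReal.ofNat_ne_top)).liminf_eq

theorem memLp_inv_fst_smul (hu : u ∈ H10 θ) :
    MemLp (fun p => p.1⁻¹ • u p) 2 (flatMeasure θ) :=
  ⟨(measurable_fst.inv.aestronglyMeasurable).smul (Lp.aestronglyMeasurable u),
    (eLpNorm_inv_fst_smul_le hu).trans_lt
      (ENNReal.mul_lt_top ENNReal.ofNat_lt_top (Lp.eLpNorm_lt_top _))⟩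

theorem integrable_norm_sq_div_sq (hu : u ∈ H10 θ) :
    Integrable (fun p : ℝ × ℝ => ‖u p‖ ^ 2 / p.1 ^ 2) (flatMeasure θ) := by
  simpa only [norm_inv_smul_sq] using (memLp_inv_fst_smul hu).integrable_norm_pow two_ne_zero

theorem integral_norm_sq_div_sq_le (hu : u ∈ H10 θ) :
    ∫ p, ‖u p‖ ^ 2 / p.1 ^ 2 ∂flatMeasure θ ≤ 4 * ‖weakPartial θ (1, 0) u‖ ^ 2 := by
  have h := pow_le_pow_left' (eLpNorm_inv_fst_smul_le hu) 2
  rw [mul_pow, ← ofReal_integral_norm_sq (memLp_inv_fst_smul hu),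
    ← ofReal_integral_norm_sq (Lp.memLp _), ← norm_sq_eq_integral] at h
  simp only [norm_inv_smul_sq] at h
  refine (ENNReal.ofReal_le_ofReal_iff (by positivity)).1 (h.trans_eq ?_)
  rw [ENNReal.ofReal_mul (by norm_num)]
  norm_num

theorem flatForm_eq (ω : ℝ) (m : ℤ) (hu : u ∈ H10 θ) :
    flatForm θ ω m u = ‖weakPartial θ (1, 0) u‖ ^ 2 + ‖weakPartial θ (0, 1) u‖ ^ 2
      + (((m : ℝ) - ω) ^ 2 - 1 / 4) * ∫ p, ‖u p‖ ^ 2 / p.1 ^ 2 ∂flatMeasure θ := by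
  have hsq (g : L2Flat θ) : Integrable (fun p => ‖g p‖ ^ 2) (flatMeasure θ) :=
    (Lp.memLp g).integrable_norm_pow two_ne_zero
  rw [norm_sq_eq_integral, norm_sq_eq_integral, ← integral_const_mul,
    ← integral_add (hsq _) (hsq _), ← integral_add (by exact (hsq _).add (hsq _))
      ((integrable_norm_sq_div_sq hu).const_mul _)]
  exact integral_congr_ae (.of_forall fun p => by ring)

/-- `I` stands for Hardy's term `∫ |u|²/r²`, which the Dirichlet part `a + b` bounds. -/
theorem hardy_form_bounds {a b I γ : ℝ} (hb : 0 ≤ b) (hI : 0 ≤ I) (hIa : I ≤ 4 * a)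
    (hγ : 0 ≤ γ) :
    min 1 (4 * γ) * (a + b) ≤ a + b + (γ - 1 / 4) * I ∧
      a + b + (γ - 1 / 4) * I ≤ (1 + 4 * γ) * (a + b) := by
  constructor
  · rcases le_total (1 / 4) γ with h | h
    · rw [min_eq_left (by linarith)]
      nlinarith
    · rw [min_eq_right (by linarith)]
      nlinarith
  · nlinarith

theorem flatForm_bounds (ω : ℝ) (m : ℤ) (hu : u ∈ H10 θ) :
    min 1 (4 * ((m : ℝ) - ω) ^ 2) *
        (‖weakPartial θ (1, 0) u‖ ^ 2 + ‖weakPartial θ (0, 1) u‖ ^ 2) ≤ flatForm θ ω m u ∧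
      flatForm θ ω m u ≤ (1 + 4 * ((m : ℝ) - ω) ^ 2) *
        (‖weakPartial θ (1, 0) u‖ ^ 2 + ‖weakPartial θ (0, 1) u‖ ^ 2) := by
  rw [flatForm_eq ω m hu]
  exact hardy_form_bounds (sq_nonneg _) (integral_nonneg fun p => by positivity)
    (integral_norm_sq_div_sq_le hu) (sq_nonneg _)

theorem flatForm_nonneg (ω : ℝ) (m : ℤ) (hu : u ∈ H10 θ) : 0 ≤ flatForm θ ω m u :=
  le_trans (by positivity) (flatForm_bounds ω m hu).1

theorem mul_h1Norm_le_flatFormNorm (ω : ℝ) (m : ℤ) (hu : u ∈ H10 θ) :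
    √(min 1 (4 * ((m : ℝ) - ω) ^ 2)) * h1Norm θ u ≤ flatFormNorm θ ω m u := by
  rw [h1Norm, flatFormNorm, ← Real.sqrt_mul (by positivity)]
  refine Real.sqrt_le_sqrt ?_
  have hu2 := mul_le_of_le_one_left (sq_nonneg ‖u‖) (min_le_left 1 (4 * ((m : ℝ) - ω) ^ 2))
  linarith [(flatForm_bounds ω m hu).1]

theorem flatFormNorm_le_mul_h1Norm (ω : ℝ) (m : ℤ) (hu : u ∈ H10 θ) :
    flatFormNorm θ ω m u ≤ √(1 + 4 * ((m : ℝ) - ω) ^ 2) * h1Norm θ u := by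
  rw [h1Norm, flatFormNorm, ← Real.sqrt_mul (by positivity)]
  refine Real.sqrt_le_sqrt ?_
  have hu2 : 0 ≤ 4 * ((m : ℝ) - ω) ^ 2 * ‖u‖ ^ 2 := by positivity
  linarith [(flatForm_bounds ω m hu).2]

theorem tendsto_flatFormNorm_sub (ω : ℝ) (m : ℤ) {φ : ℕ → L2Flat θ} (hφ : ∀ n, φ n ∈ H10 θ)
    (hu : u ∈ H10 θ) (hlim : Tendsto (fun n => h1Norm θ (φ n - u)) atTop (𝓝 0)) :
    Tendsto (fun n => flatFormNorm θ ω m (φ n - u)) atTop (𝓝 0) :=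
  squeeze_zero (fun _ => Real.sqrt_nonneg _)
    (fun n => flatFormNorm_le_mul_h1Norm ω m (sub_mem_H10 (hφ n) hu))
    (by simpa using hlim.const_mul √(1 + 4 * ((m : ℝ) - ω) ^ 2))

end FlatForm

/-! ### Angular modes and angular projections -/

section Angular

variable {θ : ℝ} {f g : (ℝ × ℝ) × S1 → ℂ} {w : ℝ × ℝ → ℂ}

instance isLocallyFiniteMeasure_radialMeasure (θ : ℝ) :
    IsLocallyFiniteMeasure (radialMeasure θ) :=
  IsLocallyFiniteMeasure.withDensity_ofReal continuous_fst

instance sFinite_radialMeasure (θ : ℝ) : SFinite (radialMeasure θ) := by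
  unfold radialMeasure; infer_instance

instance isLocallyFiniteMeasure_layerMeasure (θ : ℝ) :
    IsLocallyFiniteMeasure (layerMeasure θ) := by
  unfold layerMeasure; infer_instance

theorem continuous_angularMode (m : ℤ) : Continuous (angularMode m) :=
  continuous_const.mul (fourier m).continuous

theorem hasDerivAt_angularMode (m : ℤ) (t : ℝ) :
    HasDerivAt (fun t : ℝ => angularMode m t) (Complex.I * m * angularMode m t) t := by
  refine ((hasDerivAt_fourier (2 * Real.pi) m t).const_mul _).congr_deriv ?_
  rw [angularMode]
  field_simp
  push_cast
  ring

theorem contDiff_angularMode (m : ℤ) :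
    ContDiff ℝ (⊤ : ℕ∞) (fun t : ℝ => angularMode m t) := by
  simp only [angularMode, fourier_coe_apply]
  exact contDiff_const.mul ((contDiff_const.mul Complex.ofRealCLM.contDiff).div_const _).cexp

theorem norm_angularMode_sq (m : ℤ) (φ : S1) : ‖angularMode m φ‖ ^ 2 = (2 * Real.pi)⁻¹ := by
  rw [angularMode, norm_mul, fourier_apply, Circle.norm_coe, mul_one, norm_inv,
    Complex.norm_real, inv_pow, Real.norm_eq_abs, sq_abs, Real.sq_sqrt Real.two_pi_pos.le]

theorem memLp_angularMode (m : ℤ) : MemLp (angularMode m) 2 (volume : Measure S1) :=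
  (continuous_angularMode m).memLp_of_hasCompactSupport (.of_compactSpace _)

theorem memLp_conj_angularMode (m : ℤ) :
    MemLp (fun φ => conj (angularMode m φ)) 2 (volume : Measure S1) :=
  (memLp_angularMode m).star

theorem integral_norm_angularMode_sq (m : ℤ) : ∫ φ, ‖angularMode m φ‖ ^ 2 = 1 := by
  simp only [norm_angularMode_sq, integral_const, Measure.real, AddCircle.measure_univ,
    ENNReal.toReal_ofReal Real.two_pi_pos.le, smul_eq_mul]
  exact mul_inv_cancel₀ Real.two_pi_pos.ne'

theorem eLpNorm_angularMode (m : ℤ) : eLpNorm (angularMode m) 2 volume = 1 := by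
  have h := ofReal_integral_norm_sq (memLp_angularMode m)
  rw [integral_norm_angularMode_sq, ENNReal.ofReal_one] at h
  exact (ENNReal.pow_right_strictMono two_ne_zero).injective (h.symm.trans (one_pow 2).symm)

theorem ae_memLp_slice (hf : MemLp f 2 (layerMeasure θ)) :
    ∀ᵐ p ∂radialMeasure θ, MemLp (fun φ => f (p, φ)) 2 (volume : Measure S1) := by
  have hmeas : ∀ᵐ p ∂radialMeasure θ, AEStronglyMeasurable (fun φ => f (p, φ)) volume :=
    hf.1.prodMk_left
  filter_upwards [hmeas, (hf.integrable_norm_pow two_ne_zero).prod_right_ae] with p hp hi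
  exact (memLp_two_iff_integrable_sq_norm hp).2 hi

theorem angularProj_sub (m : ℤ) {p : ℝ × ℝ} (hf : MemLp (fun φ => f (p, φ)) 2 volume)
    (hg : MemLp (fun φ => g (p, φ)) 2 volume) :
    angularProj m (fun x => f x - g x) p = angularProj m f p - angularProj m g p := by
  simp only [angularProj, sub_mul]
  exact integral_sub (hf.integrable_mul (memLp_conj_angularMode m))
    (hg.integrable_mul (memLp_conj_angularMode m))

theorem angularProj_const_mul (m : ℤ) (c : ℂ) (f : (ℝ × ℝ) × S1 → ℂ) (p : ℝ × ℝ) :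
    angularProj m (fun x => c * f x) p = c * angularProj m f p := by
  simp only [angularProj, mul_assoc, integral_const_mul]

theorem angularProj_fst_smul (m : ℤ) (h : ℝ × ℝ → ℝ) (f : (ℝ × ℝ) × S1 → ℂ) (p : ℝ × ℝ) :
    angularProj m (fun x => h x.1 • f x) p = h p • angularProj m f p := by
  simp only [angularProj, smul_mul_assoc, integral_smul]

theorem angularProj_mul_angularMode (m : ℤ) (w : ℝ × ℝ → ℂ) (p : ℝ × ℝ) :
    angularProj m (fun x => w x.1 * angularMode m x.2) p = w p := by
  have hone : ∫ φ, angularMode m φ * conj (angularMode m φ) = 1 := by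
    simp only [Complex.mul_conj, Complex.normSq_eq_norm_sq]
    rw [integral_complex_ofReal, integral_norm_angularMode_sq, Complex.ofReal_one]
  simp only [angularProj, mul_assoc, integral_const_mul, hone, mul_one]

theorem enorm_angularProj_le (m : ℤ) {p : ℝ × ℝ}
    (hf : AEStronglyMeasurable (fun φ => f (p, φ)) volume) :
    ‖angularProj m f p‖ₑ ≤ eLpNorm (fun φ => f (p, φ)) 2 volume := by
  calc ‖angularProj m f p‖ₑ
      ≤ eLpNorm (fun φ => f (p, φ) • conj (angularMode m φ)) 1 volume := by
        rw [eLpNorm_one_eq_lintegral_enorm]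
        exact enorm_integral_le_lintegral_enorm _
    _ ≤ eLpNorm (fun φ => f (p, φ)) 2 volume * eLpNorm (fun φ => conj (angularMode m φ)) 2 volume :=
        eLpNorm_smul_le_mul_eLpNorm (p := 2) (q := 2) (r := 1)
          (φ := fun φ => f (p, φ)) (memLp_conj_angularMode m).1 hf
    _ = eLpNorm (fun φ => f (p, φ)) 2 volume := by
        rw [eLpNorm_congr_norm_ae (f := fun φ => conj (angularMode m φ)) (g := angularMode m)
          (.of_forall fun φ => RCLike.norm_conj _),
          eLpNorm_angularMode, mul_one]

theorem eLpNorm_angularProj_le (m : ℤ) (hf : AEStronglyMeasurable f (layerMeasure θ)) :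
    eLpNorm (angularProj m f) 2 (radialMeasure θ) ≤ eLpNorm f 2 (layerMeasure θ) := by
  rw [← ENNReal.pow_le_pow_left_iff two_ne_zero, eLpNorm_two_sq, eLpNorm_two_sq, layerMeasure,
    lintegral_prod _ (hf.enorm.pow_const _)]
  refine lintegral_mono_ae ?_
  have hslice : ∀ᵐ p ∂radialMeasure θ, AEStronglyMeasurable (fun φ => f (p, φ)) volume :=
    hf.prodMk_left
  filter_upwards [hslice] with p hp
  rw [← eLpNorm_two_sq]
  gcongr
  exact enorm_angularProj_le m hp

theorem integral_norm_angularProj_sq_le (m : ℤ) (hf : MemLp f 2 (layerMeasure θ)) :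
    ∫ p, ‖angularProj m f p‖ ^ 2 ∂radialMeasure θ ≤ ∫ x, ‖f x‖ ^ 2 ∂layerMeasure θ := by
  have hmeas : AEStronglyMeasurable (angularProj m f) (radialMeasure θ) :=
    (hf.1.mul (memLp_conj_angularMode m).1.comp_snd).integral_prod_right'
  have hπf : MemLp (angularProj m f) 2 (radialMeasure θ) :=
    ⟨hmeas, (eLpNorm_angularProj_le m hf.1).trans_lt hf.2⟩
  refine (ENNReal.ofReal_le_ofReal_iff (integral_nonneg fun _ => sq_nonneg _)).1 ?_
  rw [ofReal_integral_norm_sq hπf, ofReal_integral_norm_sq hf]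
  gcongr
  exact eLpNorm_angularProj_le m hf.1

theorem eLpNorm_mul_angularMode (m : ℤ) (hw : AEStronglyMeasurable w (radialMeasure θ)) :
    eLpNorm (fun x : (ℝ × ℝ) × S1 => w x.1 * angularMode m x.2) 2 (layerMeasure θ) =
      eLpNorm w 2 (radialMeasure θ) := by
  refine (ENNReal.pow_right_strictMono two_ne_zero).injective ?_
  simp only [eLpNorm_two_sq, enorm_mul, mul_pow]
  rw [layerMeasure, lintegral_prod_mul (hw.enorm.pow_const _)
    ((continuous_angularMode m).enorm.aemeasurable.pow_const _), ← eLpNorm_two_sq (angularMode m),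
    eLpNorm_angularMode, one_pow, mul_one]

theorem integral_norm_mul_angularMode_sq (m : ℤ) (w : ℝ × ℝ → ℂ) :
    ∫ x : (ℝ × ℝ) × S1, ‖w x.1 * angularMode m x.2‖ ^ 2 ∂layerMeasure θ =
      ∫ p, ‖w p‖ ^ 2 ∂radialMeasure θ := by
  simp only [norm_mul, mul_pow]
  rw [layerMeasure, integral_prod_mul (fun p => ‖w p‖ ^ 2) fun φ => ‖angularMode m φ‖ ^ 2,
    integral_norm_angularMode_sq, mul_one]

end Angular

/-! ### Test functions on the layer -/

section LayerTest

variable {θ : ℝ} {v w : (ℝ × ℝ) × S1 → ℂ}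

/-- The lift of a function on the layer to the universal cover in the angle: `2π`-periodic in the
last variable, and a function on a vector space, which is what `fderiv` needs. -/
def layerLift (v : (ℝ × ℝ) × S1 → ℂ) (x : (ℝ × ℝ) × ℝ) : ℂ := v (x.1, (x.2 : S1))

/-- The classical derivative in the layer in the direction `e` of the `(r, z)`-plane. -/
def layerD (e : ℝ × ℝ) (v : (ℝ × ℝ) × S1 → ℂ) (x : (ℝ × ℝ) × S1) : ℂ :=
  fderiv ℝ (fun p => v (p, x.2)) x.1 e

/-- The angular part `i∂_φ - ω` of the magnetic gradient; with the factor `1 / r` it is the angular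
component of `i∇ - A_ω`. -/
def magneticDphi (ω : ℝ) (v : (ℝ × ℝ) × S1 → ℂ) (x : (ℝ × ℝ) × S1) : ℂ :=
  Complex.I * layerDphi v x - ω * v x

theorem continuous_of_continuous_layerLift (h : Continuous (layerLift v)) : Continuous v :=
  (IsOpenQuotientMap.id.prodMap
    QuotientAddGroup.isOpenQuotientMap_mk).isQuotientMap.continuous_iff.2 h

theorem layerLift_eventuallyEq_zero {p : ℝ × ℝ} {t : ℝ} (h : (p, (t : S1)) ∉ tsupport v) :
    layerLift v =ᶠ[𝓝 (p, t)] 0 := by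
  have hcover : Continuous fun x : (ℝ × ℝ) × ℝ => (x.1, (x.2 : S1)) :=
    continuous_fst.prodMk ((AddCircle.continuous_mk' _).comp continuous_snd)
  exact (hcover.tendsto (p, t)).eventually (notMem_tsupport_iff_eventuallyEq.1 h)

theorem tsupport_layerLift_subset :
    tsupport (layerLift v) ⊆ {x | (x.1, (x.2 : S1)) ∈ tsupport v} := fun _ hx =>
  by_contra fun h => notMem_tsupport_iff_eventuallyEq.2 (layerLift_eventuallyEq_zero h) hx

namespace IsLayerTest

theorem continuous (hv : IsLayerTest θ v) : Continuous v :=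
  continuous_of_continuous_layerLift hv.smooth.continuous

theorem memLp (hv : IsLayerTest θ v) : MemLp v 2 (layerMeasure θ) :=
  hv.continuous.memLp_of_hasCompactSupport hv.compact

theorem contDiff_layerLift (hv : IsLayerTest θ v) : ContDiff ℝ (⊤ : ℕ∞) (layerLift v) :=
  hv.smooth

theorem differentiable_layerLift (hv : IsLayerTest θ v) : Differentiable ℝ (layerLift v) :=
  hv.contDiff_layerLift.differentiable (by simp)

theorem of_eq_zero_of_notMem_tsupport (hv : IsLayerTest θ v)
    (hw : ContDiff ℝ (⊤ : ℕ∞) (layerLift w)) (h : ∀ x ∉ tsupport v, w x = 0) :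
    IsLayerTest θ w := by
  have hsupp : Function.support w ⊆ tsupport v := fun x hx => by_contra fun hx' => hx (h x hx')
  exact ⟨hw, hv.compact.mono' hsupp,
    (closure_minimal hsupp (isClosed_tsupport v)).trans hv.support⟩

theorem of_eq_fderiv_layerLift (hv : IsLayerTest θ v) (e : (ℝ × ℝ) × ℝ)
    (hw : ∀ p (t : ℝ), w (p, t) = fderiv ℝ (layerLift v) (p, t) e) : IsLayerTest θ w := by
  refine hv.of_eq_zero_of_notMem_tsupport ?_ ?_
  · rw [show layerLift w = fun x => fderiv ℝ (layerLift v) x e from funext fun x => hw x.1 x.2]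
    exact (hv.contDiff_layerLift.fderiv_right (by simp)).clm_apply contDiff_const
  · rintro ⟨p, φ⟩ hx
    obtain ⟨t, rfl⟩ := QuotientAddGroup.mk_surjective φ
    rw [hw, (layerLift_eventuallyEq_zero hx).fderiv_eq, fderiv_zero]
    rfl

theorem hasFDerivAt_slice (hv : IsLayerTest θ v) (p : ℝ × ℝ) (t : ℝ) :
    HasFDerivAt (fun p => v (p, (t : S1)))
      ((fderiv ℝ (layerLift v) (p, t)).comp (ContinuousLinearMap.inl ℝ (ℝ × ℝ) ℝ)) p :=
  hasFDerivAt_comp_prodMk_left (hv.differentiable_layerLift (p, t))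

theorem layerD_coe (hv : IsLayerTest θ v) (e p : ℝ × ℝ) (t : ℝ) :
    layerD e v (p, t) = fderiv ℝ (layerLift v) (p, t) (e, 0) := by
  rw [layerD, (hv.hasFDerivAt_slice p t).fderiv]
  rfl

theorem layerDphi_coe (hv : IsLayerTest θ v) (p : ℝ × ℝ) (t : ℝ) :
    layerDphi v (p, t) = fderiv ℝ (layerLift v) (p, t) (0, 1) := by
  have hline : HasDerivAt (fun s : ℝ => (p, t + s)) ((0 : ℝ × ℝ), (1 : ℝ)) 0 :=
    (hasDerivAt_const _ _).prodMk ((hasDerivAt_id (0 : ℝ)).const_add t)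
  have hcomp := (hv.differentiable_layerLift (p, t + 0)).hasFDerivAt.comp_hasDerivAt (0 : ℝ) hline
  rw [add_zero] at hcomp
  exact hcomp.deriv

theorem hasDerivAt_angular (hv : IsLayerTest θ v) (p : ℝ × ℝ) (t : ℝ) :
    HasDerivAt (fun s : ℝ => v (p, s)) (layerDphi v (p, t)) t := by
  rw [hv.layerDphi_coe]
  exact (hv.differentiable_layerLift (p, t)).hasFDerivAt.comp_hasDerivAt t
    ((hasDerivAt_const t p).prodMk (hasDerivAt_id t))

protected theorem layerD (hv : IsLayerTest θ v) (e : ℝ × ℝ) : IsLayerTest θ (layerD e v) :=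
  hv.of_eq_fderiv_layerLift _ (hv.layerD_coe e)

protected theorem layerDphi (hv : IsLayerTest θ v) : IsLayerTest θ (layerDphi v) :=
  hv.of_eq_fderiv_layerLift _ hv.layerDphi_coe

theorem sub (hv : IsLayerTest θ v) (hw : IsLayerTest θ w) :
    IsLayerTest θ (fun x => v x - w x) where
  smooth := hv.smooth.sub hw.smooth
  compact := hv.compact.sub hw.compact
  support := (tsupport_sub v w).trans (Set.union_subset hv.support hw.support)

theorem const_mul (hv : IsLayerTest θ v) (c : ℂ) : IsLayerTest θ (fun x => c * v x) where
  smooth := contDiff_const.mul hv.smooth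
  compact := hv.compact.mul_left (f := fun _ => c)
  support := (tsupport_mul_subset_right (f := fun _ => c)).trans hv.support

theorem inv_fst_smul (hv : IsLayerTest θ v) : IsLayerTest θ (fun x => x.1.1⁻¹ • v x) := by
  have hfst : ∀ x ∈ tsupport (layerLift v), ContDiffAt ℝ (⊤ : ℕ∞) (fun x => x.1.1⁻¹) x :=
    fun x hx => contDiffAt_fst.fst.inv (hv.support (tsupport_layerLift_subset hx)).1.1.ne'
  refine hv.of_eq_zero_of_notMem_tsupport
    (contDiff_smul_of_contDiffAt_tsupport hv.contDiff_layerLift hfst) fun x hx => ?_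
  rw [image_eq_zero_of_notMem_tsupport hx, smul_zero]

protected theorem magneticDphi (hv : IsLayerTest θ v) (ω : ℝ) :
    IsLayerTest θ (magneticDphi ω v) :=
  (hv.layerDphi.const_mul Complex.I).sub (hv.const_mul ω)

theorem layerForm_eq (hv : IsLayerTest θ v) (ω : ℝ) :
    layerForm θ ω v = ∫ x, ‖layerD (1, 0) v x‖ ^ 2 ∂layerMeasure θ +
      ∫ x, ‖layerD (0, 1) v x‖ ^ 2 ∂layerMeasure θ +
      ∫ x, ‖x.1.1⁻¹ • magneticDphi ω v x‖ ^ 2 ∂layerMeasure θ := by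
  have hsq : ∀ {w}, IsLayerTest θ w → Integrable (fun x => ‖w x‖ ^ 2) (layerMeasure θ) :=
    fun hw => hw.memLp.integrable_norm_pow two_ne_zero
  rw [← integral_add (hsq (hv.layerD _)) (hsq (hv.layerD _)),
    ← integral_add (by exact (hsq (hv.layerD _)).add (hsq (hv.layerD _)))
      (hsq (hv.magneticDphi ω).inv_fst_smul)]
  refine integral_congr_ae (.of_forall fun x => ?_)
  simp only [norm_inv_smul_sq]
  rfl

end IsLayerTest

end LayerTest

/-! ### Separation of the angular variable -/

section Separation

variable {θ : ℝ} {v : (ℝ × ℝ) × S1 → ℂ} {w : ℝ × ℝ → ℂ}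

theorem angularProj_eq_intervalIntegral (m : ℤ) (v : (ℝ × ℝ) × S1 → ℂ) (p : ℝ × ℝ) :
    angularProj m v p =
      ∫ t in (0 : ℝ)..2 * Real.pi, v (p, (t : S1)) * conj (angularMode m (t : S1)) := by
  have h := AddCircle.intervalIntegral_preimage (2 * Real.pi) 0
    fun φ => v (p, φ) * conj (angularMode m φ)
  rw [zero_add] at h
  exact h.symm

namespace IsLayerTest

theorem contDiff_mul_conj_angularMode (hv : IsLayerTest θ v) (m : ℤ) :
    ContDiff ℝ (⊤ : ℕ∞) fun x : (ℝ × ℝ) × ℝ =>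
      layerLift v x * conj (angularMode m (x.2 : S1)) :=
  hv.contDiff_layerLift.mul
    (Complex.conjCLE.contDiff.comp ((contDiff_angularMode m).comp contDiff_snd))

theorem isGuiTest_angularProj (hv : IsLayerTest θ v) (m : ℤ) :
    IsGuiTest θ (angularProj m v) := by
  have hK : IsCompact (Prod.fst '' tsupport v) := hv.compact.isCompact.image continuous_fst
  have hzero : ∀ p ∉ Prod.fst '' tsupport v, angularProj m v p = 0 := fun p hp => by
    have hslice : ∀ φ : S1, v (p, φ) = 0 := fun φ =>
      image_eq_zero_of_notMem_tsupport fun h => hp ⟨_, h, rfl⟩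
    simp [angularProj, hslice]
  refine ⟨?_, HasCompactSupport.intro hK hzero, ?_⟩
  · rw [funext (angularProj_eq_intervalIntegral m v)]
    exact contDiff_intervalIntegral (hv.contDiff_mul_conj_angularMode m) 0 (2 * Real.pi)
  · have hsupp : Function.support (angularProj m v) ⊆ Prod.fst '' tsupport v :=
      fun p hp => by_contra fun h => hp (hzero p h)
    refine (closure_minimal hsupp hK.isClosed).trans ?_
    rintro _ ⟨x, hx, rfl⟩
    exact (hv.support hx).1

theorem fderiv_angularProj (hv : IsLayerTest θ v) (m : ℤ) (p e : ℝ × ℝ) :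
    fderiv ℝ (angularProj m v) p e = angularProj m (layerD e v) p := by
  let F : (ℝ × ℝ) × ℝ → ℂ := fun x => layerLift v x * conj (angularMode m (x.2 : S1))
  have hF : ContDiff ℝ (⊤ : ℕ∞) F := hv.contDiff_mul_conj_angularMode m
  have hproj : angularProj m v = fun p => ∫ t in (0 : ℝ)..2 * Real.pi, F (p, t) :=
    funext (angularProj_eq_intervalIntegral m v)
  have hcont : Continuous fun t : ℝ =>
      (fderiv ℝ F (p, t)).comp (ContinuousLinearMap.inl ℝ (ℝ × ℝ) ℝ) :=
    ((hF.continuous_fderiv (by simp)).comp (by fun_prop)).clm_comp continuous_const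
  rw [hproj, (hasFDerivAt_intervalIntegral_of_contDiff (hF.of_le (by simp)) 0 _ p).fderiv,
    angularProj_eq_intervalIntegral,
    ContinuousLinearMap.intervalIntegral_apply (hcont.intervalIntegrable _ _)]
  refine intervalIntegral.integral_congr fun t _ => ?_
  have hslice := (hasFDerivAt_comp_prodMk_left (hF.differentiable (by simp) (p, t))).unique
    ((hv.hasFDerivAt_slice p t).mul_const (conj (angularMode m (t : S1))))
  refine (DFunLike.congr_fun hslice e).trans ?_
  simp [hv.layerD_coe, mul_comm]

theorem angularProj_layerDphi (hv : IsLayerTest θ v) (m : ℤ) (p : ℝ × ℝ) :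
    angularProj m (layerDphi v) p = Complex.I * m * angularProj m v p := by
  have hint : ∀ {u}, IsLayerTest θ u → IntervalIntegrable
      (fun t : ℝ => u (p, (t : S1)) * conj (angularMode m (t : S1))) volume 0 (2 * Real.pi) :=
    fun hu => ((hu.contDiff_mul_conj_angularMode m).continuous.comp
      (by fun_prop : Continuous fun t : ℝ => (p, t))).intervalIntegrable _ _
  have hderiv : ∀ t : ℝ, HasDerivAt (fun t : ℝ => v (p, (t : S1)) * conj (angularMode m (t : S1)))
      (layerDphi v (p, (t : S1)) * conj (angularMode m (t : S1)) -
        Complex.I * m * (v (p, (t : S1)) * conj (angularMode m (t : S1)))) t := fun t => by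
    refine ((hv.hasDerivAt_angular p t).mul (hasDerivAt_angularMode m t).star).congr_deriv ?_
    simp only [RCLike.star_def, map_mul, Complex.conj_I, map_intCast]
    ring
  have hderiv_int := (hint hv.layerDphi).sub ((hint hv).const_mul (Complex.I * m))
  have hperiod : ((2 * Real.pi : ℝ) : S1) = ((0 : ℝ) : S1) := by simp
  have hboundary := intervalIntegral.integral_eq_sub_of_hasDerivAt (fun t _ => hderiv t) hderiv_int
  rw [intervalIntegral.integral_sub (hint hv.layerDphi) ((hint hv).const_mul _), hperiod, sub_self,
    sub_eq_zero, intervalIntegral.integral_const_mul] at hboundary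
  rwa [angularProj_eq_intervalIntegral, angularProj_eq_intervalIntegral]

end IsLayerTest

end Separation

section FiberForm

variable {θ : ℝ} {v : (ℝ × ℝ) × S1 → ℂ} {w : ℝ × ℝ → ℂ}

/-- The form of a single angular mode on `L²(Gui(θ); r dr dz)`,
`w ↦ ∫ (|∂_r w|² + |∂_z w|² + c |w|² / r²) r dr dz`, for a differentiable `w`. -/
def fiberForm (θ c : ℝ) (w : ℝ × ℝ → ℂ) : ℝ :=
  ∫ p, ‖fderiv ℝ w p (1, 0)‖ ^ 2 ∂radialMeasure θ +
    ∫ p, ‖fderiv ℝ w p (0, 1)‖ ^ 2 ∂radialMeasure θ +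
    c * ∫ p, ‖p.1⁻¹ • w p‖ ^ 2 ∂radialMeasure θ

theorem fiberForm_nonneg {c : ℝ} (hc : 0 ≤ c) (w : ℝ × ℝ → ℂ) : 0 ≤ fiberForm θ c w := by
  unfold fiberForm
  positivity

theorem layerForm_nonneg (θ ω : ℝ) (v : (ℝ × ℝ) × S1 → ℂ) : 0 ≤ layerForm θ ω v :=
  integral_nonneg fun _ => by positivity

namespace IsLayerTest

theorem memLp_slice (hv : IsLayerTest θ v) (p : ℝ × ℝ) :
    MemLp (fun φ => v (p, φ)) 2 (volume : Measure S1) :=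
  (hv.continuous.comp (by fun_prop)).memLp_of_hasCompactSupport (.of_compactSpace _)

/-- With the sign convention of `layerForm` the mode `e^{imφ}` carries the coefficient `(m + ω)²`,
whereas `flatForm` is written with `(m - ω)²`. The two are reconciled only by Hardy's inequality,
which makes all positive coefficients give the same form domain. -/
theorem angularProj_magneticDphi (hv : IsLayerTest θ v) (ω : ℝ) (m : ℤ) (p : ℝ × ℝ) :
    angularProj m (magneticDphi ω v) p = -((m + ω : ℝ) : ℂ) * angularProj m v p := by
  have hsub := angularProj_sub m (f := fun x => Complex.I * layerDphi v x)
    (g := fun x => ω * v x) ((hv.layerDphi.const_mul _).memLp_slice p)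
    ((hv.const_mul _).memLp_slice p)
  rw [angularProj_const_mul, angularProj_const_mul, hv.angularProj_layerDphi] at hsub
  refine hsub.trans ?_
  push_cast
  linear_combination (m : ℂ) * angularProj m v p * Complex.I_mul_I

theorem fiberForm_angularProj_le (hv : IsLayerTest θ v) (ω : ℝ) (m : ℤ) :
    fiberForm θ ((m + ω) ^ 2) (angularProj m v) ≤ layerForm θ ω v := by
  have hangular : (m + ω) ^ 2 * ∫ p, ‖p.1⁻¹ • angularProj m v p‖ ^ 2 ∂radialMeasure θ =
      ∫ p, ‖angularProj m (fun x => x.1.1⁻¹ • magneticDphi ω v x) p‖ ^ 2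
        ∂radialMeasure θ := by
    rw [← integral_const_mul]
    refine integral_congr_ae (.of_forall fun p => ?_)
    simp only [angularProj_fst_smul m (fun p => p.1⁻¹), hv.angularProj_magneticDphi,
      norm_inv_smul_sq, norm_mul, norm_neg, Complex.norm_real, mul_pow, Real.norm_eq_abs, sq_abs]
    ring
  rw [hv.layerForm_eq ω, fiberForm, hangular]
  simp only [hv.fderiv_angularProj]
  gcongr
  · exact integral_norm_angularProj_sq_le m (hv.layerD _).memLp
  · exact integral_norm_angularProj_sq_le m (hv.layerD _).memLp
  · exact integral_norm_angularProj_sq_le m (hv.magneticDphi ω).inv_fst_smul.memLp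

end IsLayerTest

namespace IsGuiTest

theorem mul_angularMode (hw : IsGuiTest θ w) (m : ℤ) :
    IsLayerTest θ (fun x => w x.1 * angularMode m x.2) := by
  have hzero : ∀ x : (ℝ × ℝ) × S1, x ∉ tsupport w ×ˢ Set.univ →
      w x.1 * angularMode m x.2 = 0 := fun x hx => by
    rw [image_eq_zero_of_notMem_tsupport fun h => hx ⟨h, trivial⟩, zero_mul]
  have hsupp : Function.support (fun x : (ℝ × ℝ) × S1 => w x.1 * angularMode m x.2) ⊆
      tsupport w ×ˢ Set.univ := fun x hx => by_contra fun h => hx (hzero x h)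
  refine ⟨?_, HasCompactSupport.intro (hw.compact.isCompact.prod isCompact_univ) hzero, ?_⟩
  · exact (hw.smooth.comp contDiff_fst).mul ((contDiff_angularMode m).comp contDiff_snd)
  · exact (closure_minimal hsupp ((isClosed_tsupport w).prod isClosed_univ)).trans
      (Set.prod_mono_left hw.support)

theorem layerD_mul_angularMode (hw : IsGuiTest θ w) (m : ℤ) (e : ℝ × ℝ) (x : (ℝ × ℝ) × S1) :
    layerD e (fun x => w x.1 * angularMode m x.2) x =
      fderiv ℝ w x.1 e * angularMode m x.2 := by
  rw [layerD, ((hw.differentiable x.1).hasFDerivAt.mul_const (angularMode m x.2)).fderiv]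
  simp [mul_comm]

end IsGuiTest

theorem layerDphi_mul_angularMode (m : ℤ) (w : ℝ × ℝ → ℂ) (x : (ℝ × ℝ) × S1) :
    layerDphi (fun x => w x.1 * angularMode m x.2) x =
      Complex.I * m * (w x.1 * angularMode m x.2) := by
  obtain ⟨p, φ⟩ := x
  obtain ⟨t, rfl⟩ := QuotientAddGroup.mk_surjective φ
  have h := ((hasDerivAt_angularMode m (t + 0)).comp_const_add t 0).const_mul (w p)
  rw [add_zero] at h
  exact h.deriv.trans (mul_left_comm _ _ _)

theorem magneticDphi_mul_angularMode (ω : ℝ) (m : ℤ) (w : ℝ × ℝ → ℂ) (x : (ℝ × ℝ) × S1) :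
    magneticDphi ω (fun x => w x.1 * angularMode m x.2) x =
      -((m + ω : ℝ) : ℂ) * (w x.1 * angularMode m x.2) := by
  rw [magneticDphi, layerDphi_mul_angularMode]
  push_cast
  linear_combination (m : ℂ) * (w x.1 * angularMode m x.2) * Complex.I_mul_I

theorem IsGuiTest.layerForm_mul_angularMode (hw : IsGuiTest θ w) (ω : ℝ) (m : ℤ) :
    layerForm θ ω (fun x => w x.1 * angularMode m x.2) = fiberForm θ ((m + ω) ^ 2) w := by
  have hangular : ∀ x : (ℝ × ℝ) × S1,
      ‖x.1.1⁻¹ • magneticDphi ω (fun x => w x.1 * angularMode m x.2) x‖ ^ 2 =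
        (m + ω) ^ 2 * ‖(x.1.1⁻¹ • w x.1) * angularMode m x.2‖ ^ 2 := fun x => by
    rw [magneticDphi_mul_angularMode, smul_mul_assoc, norm_inv_smul_sq, norm_inv_smul_sq, norm_mul,
      norm_neg, Complex.norm_real, mul_pow, Real.norm_eq_abs, sq_abs, mul_div_assoc]
  rw [(hw.mul_angularMode m).layerForm_eq, fiberForm]
  simp only [hw.layerD_mul_angularMode, hangular, integral_const_mul]
  rw [integral_norm_mul_angularMode_sq m fun p => fderiv ℝ w p (1, 0),
    integral_norm_mul_angularMode_sq m fun p => fderiv ℝ w p (0, 1),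
    integral_norm_mul_angularMode_sq m fun p => p.1⁻¹ • w p]

theorem fiberFormDomain_subset (θ ω : ℝ) (m : ℤ) :
    fiberFormDomain θ ω m ⊆
      formDomain (radialMeasure θ) (IsGuiTest θ) (fiberForm θ ((m + ω) ^ 2)) := by
  rintro w ⟨u, hu, hw⟩
  refine mem_formDomain_of_map (T := IsLayerTest θ) (angularProj m) 1 hu
    (fun v hv => hv.isGuiTest_angularProj m) (fun v hv => ?_)
    (fun _ => fiberForm_nonneg (sq_nonneg _) _) fun v v' hv hv' => ?_
  · have hproj : (fun p => angularProj m v p - w p) =ᵐ[radialMeasure θ]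
        angularProj m fun x => v x - u x := by
      filter_upwards [hw, ae_memLp_slice (Lp.memLp u)] with p hp hslice
      rw [hp, angularProj_sub m (hv.memLp_slice p) hslice]
    rw [eLpNorm_congr_ae hproj]
    exact eLpNorm_angularProj_le m (hv.memLp.sub (Lp.memLp u)).1
  · simp only [← angularProj_sub m (hv.memLp_slice _) (hv'.memLp_slice _), one_mul]
    exact (hv.sub hv').fiberForm_angularProj_le ω m

theorem formDomain_fiberForm_subset (θ ω : ℝ) (m : ℤ) :
    formDomain (radialMeasure θ) (IsGuiTest θ) (fiberForm θ ((m + ω) ^ 2)) ⊆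
      fiberFormDomain θ ω m := by
  intro w hw
  have hmeas : AEStronglyMeasurable (fun x : (ℝ × ℝ) × S1 => w x.1 * angularMode m x.2)
      (layerMeasure θ) :=
    (Lp.aestronglyMeasurable w).comp_fst.mul (memLp_angularMode m).1.comp_snd
  have hmem : MemLp (fun x : (ℝ × ℝ) × S1 => w x.1 * angularMode m x.2) 2 (layerMeasure θ) :=
    ⟨hmeas, (eLpNorm_mul_angularMode m (Lp.aestronglyMeasurable w)).trans_lt
      (Lp.eLpNorm_lt_top w)⟩
  refine ⟨hmem.toLp _, ?_, ?_⟩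
  · refine mem_formDomain_of_map (T' := IsLayerTest θ) (Q' := layerForm θ ω)
      (fun φ x => φ x.1 * angularMode m x.2) 1 hw (fun φ hφ => hφ.mul_angularMode m)
      (fun φ hφ => ?_) (layerForm_nonneg θ ω) fun φ ψ hφ hψ => ?_
    · rw [← eLpNorm_mul_angularMode m (w := fun p => φ p - w p)
        (hφ.smooth.continuous.aestronglyMeasurable.sub (Lp.aestronglyMeasurable w))]
      refine (eLpNorm_congr_ae ?_).le
      filter_upwards [hmem.coeFn_toLp] with x hx
      rw [hx, sub_mul]
    · simp only [← sub_mul, one_mul]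
      exact ((hφ.sub hψ).layerForm_mul_angularMode ω m).le
  · have hslice : ∀ᵐ p ∂radialMeasure θ, ∀ᵐ φ : S1,
        hmem.toLp _ (p, φ) = w p * angularMode m φ := Measure.ae_ae_of_ae_prod hmem.coeFn_toLp
    filter_upwards [hslice] with p hp
    rw [← angularProj_mul_angularMode m w p]
    exact (integral_congr_ae (hp.mono fun φ hφ => by simp only [hφ])).symm

end FiberForm

/-! ### From the radial to the flat measure -/

section Flattening

variable {θ c : ℝ} {φ w : ℝ × ℝ → ℂ}

theorem radialMeasure_ae_eq (θ : ℝ) : ae (radialMeasure θ) = ae (flatMeasure θ) := by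
  refine le_antisymm (withDensity_absolutelyContinuous _ _).ae_le ?_
  refine (withDensity_absolutelyContinuous' (by fun_prop) ?_).ae_le
  filter_upwards [ae_fst_pos θ] with p hp
  exact (ENNReal.ofReal_pos.2 hp).ne'

theorem eLpNorm_radialMeasure (θ : ℝ) (w : ℝ × ℝ → ℂ) :
    eLpNorm w 2 (radialMeasure θ) = eLpNorm (fun p => √p.1 • w p) 2 (flatMeasure θ) := by
  refine (ENNReal.pow_right_strictMono two_ne_zero).injective ?_
  simp only [eLpNorm_two_sq]
  rw [radialMeasure, lintegral_withDensity_eq_lintegral_mul_non_measurable _ (by fun_prop)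
    (.of_forall fun _ => ENNReal.ofReal_lt_top)]
  refine lintegral_congr_ae ?_
  filter_upwards [ae_fst_pos θ] with p hp
  rw [enorm_smul, mul_pow, Real.enorm_of_nonneg (Real.sqrt_nonneg _),
    ← ENNReal.ofReal_pow (Real.sqrt_nonneg _), Real.sq_sqrt hp.le, Pi.mul_apply]

theorem integral_norm_sq_radialMeasure (θ : ℝ) (w : ℝ × ℝ → ℂ) :
    ∫ p, ‖w p‖ ^ 2 ∂radialMeasure θ = ∫ p, ‖√p.1 • w p‖ ^ 2 ∂flatMeasure θ := by
  rw [radialMeasure, integral_withDensity_eq_integral_toReal_smul (by fun_prop) (by simp)]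
  refine integral_congr_ae ?_
  filter_upwards [ae_fst_pos θ] with p hp
  rw [ENNReal.toReal_ofReal hp.le, norm_smul, mul_pow, Real.norm_eq_abs, sq_abs,
    Real.sq_sqrt hp.le, smul_eq_mul]

theorem ae_sqrt_fst_smul_inv (u : ℝ × ℝ → ℂ) :
    ∀ᵐ p ∂flatMeasure θ, √p.1 • (√p.1)⁻¹ • u p = u p := by
  filter_upwards [ae_fst_pos θ] with p hp
  exact smul_inv_smul₀ (Real.sqrt_pos.2 hp).ne' _

namespace IsGuiTest

theorem sqrt_fst_smul (hw : IsGuiTest θ w) : IsGuiTest θ fun p => √p.1 • w p :=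
  hw.smul_left fun _ hp => contDiffAt_fst.sqrt hp.ne'

theorem inv_sqrt_fst_smul (hφ : IsGuiTest θ φ) : IsGuiTest θ fun p => (√p.1)⁻¹ • φ p :=
  hφ.smul_left fun _ hp => (contDiffAt_fst.sqrt hp.ne').inv (Real.sqrt_pos.2 hp).ne'

theorem sqrt_fst_smul_inv_sqrt_fst_smul (hφ : IsGuiTest θ φ) :
    (fun p => √p.1 • (√p.1)⁻¹ • φ p) = φ := by
  funext p
  by_cases hp : p ∈ Gui θ
  · exact smul_inv_smul₀ (Real.sqrt_pos.2 hp.1).ne' _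
  · rw [hφ.eq_zero_of_notMem hp, smul_zero, smul_zero]

theorem fderiv_sqrt_fst_smul (hw : IsGuiTest θ w) {p : ℝ × ℝ} (hp : 0 < p.1) (e : ℝ × ℝ) :
    fderiv ℝ (fun p => √p.1 • w p) p e =
      √p.1 • fderiv ℝ w p e + (e.1 / 2) • p.1⁻¹ • √p.1 • w p := by
  have hsqrt := (hasFDerivAt_fst (𝕜 := ℝ) (p := p)).sqrt hp.ne'
  rw [(hsqrt.fun_smul (hw.differentiable p).hasFDerivAt).fderiv]
  have hr : p.1⁻¹ * √p.1 = (√p.1)⁻¹ := by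
    rw [inv_mul_eq_div, Real.sqrt_div_self', one_div]
  simp only [add_apply, smul_apply, ContinuousLinearMap.smulRight_apply,
    ContinuousLinearMap.coe_fst', smul_eq_mul]
  rw [smul_smul p.1⁻¹, hr, smul_smul]
  congr 2
  field_simp

theorem fiberForm_eq (hw : IsGuiTest θ w) (c : ℝ) :
    fiberForm θ c w = dirichletForm θ (fun p => √p.1 • w p) +
      (c - 1 / 4) * ∫ p, ‖p.1⁻¹ • √p.1 • w p‖ ^ 2 ∂flatMeasure θ := by
  have hr : ∫ p, ‖√p.1 • fderiv ℝ w p (1, 0)‖ ^ 2 ∂flatMeasure θ =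
      ∫ p, ‖fderiv ℝ (fun p => √p.1 • w p) p (1, 0)‖ ^ 2 ∂flatMeasure θ -
        1 / 4 * ∫ p, ‖p.1⁻¹ • √p.1 • w p‖ ^ 2 ∂flatMeasure θ := by
    rw [← hw.sqrt_fst_smul.integral_norm_fderiv_sub_inv_fst_smul_sq]
    refine integral_congr_ae ?_
    filter_upwards [ae_fst_pos θ] with p hp
    rw [hw.fderiv_sqrt_fst_smul hp, one_div, add_sub_cancel_right]
  have hz : ∫ p, ‖√p.1 • fderiv ℝ w p (0, 1)‖ ^ 2 ∂flatMeasure θ =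
      ∫ p, ‖fderiv ℝ (fun p => √p.1 • w p) p (0, 1)‖ ^ 2 ∂flatMeasure θ := by
    refine integral_congr_ae ?_
    filter_upwards [ae_fst_pos θ] with p hp
    rw [hw.fderiv_sqrt_fst_smul hp, zero_div, zero_smul, add_zero]
  simp only [fiberForm, dirichletForm, integral_norm_sq_radialMeasure, smul_comm √_ (_ : ℝ)⁻¹]
  rw [hr, hz]
  ring

theorem fiberForm_bounds (hw : IsGuiTest θ w) (hc : 0 ≤ c) :
    min 1 (4 * c) * dirichletForm θ (fun p => √p.1 • w p) ≤ fiberForm θ c w ∧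
      fiberForm θ c w ≤ (1 + 4 * c) * dirichletForm θ (fun p => √p.1 • w p) := by
  rw [hw.fiberForm_eq, dirichletForm]
  exact hardy_form_bounds (by positivity) (by positivity)
    hw.sqrt_fst_smul.integral_norm_inv_fst_smul_sq_le hc

end IsGuiTest

theorem mem_formDomain_dirichletForm_of_fiberForm (hc : 0 < c) {w : L2Radial θ} {u : L2Flat θ}
    (huw : u =ᵐ[flatMeasure θ] fun p => √p.1 • w p)
    (hw : w ∈ formDomain (radialMeasure θ) (IsGuiTest θ) (fiberForm θ c)) :
    u ∈ formDomain (flatMeasure θ) (IsGuiTest θ) (dirichletForm θ) := by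
  refine mem_formDomain_of_map (fun φ p => √p.1 • φ p) (min 1 (4 * c))⁻¹ hw
    (fun φ hφ => hφ.sqrt_fst_smul) (fun φ _ => ?_) (fun _ => by unfold dirichletForm; positivity)
    fun φ ψ hφ hψ => ?_
  · rw [eLpNorm_radialMeasure]
    refine (eLpNorm_congr_ae ?_).le
    filter_upwards [huw] with p hp
    rw [hp, smul_sub]
  · simp only [← smul_sub]
    rw [le_inv_mul_iff₀ (by positivity)]
    exact ((hφ.sub hψ).fiberForm_bounds hc.le).1

theorem mem_formDomain_fiberForm_of_dirichletForm (hc : 0 ≤ c) {w : L2Radial θ} {u : L2Flat θ}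
    (huw : u =ᵐ[flatMeasure θ] fun p => √p.1 • w p)
    (hu : u ∈ formDomain (flatMeasure θ) (IsGuiTest θ) (dirichletForm θ)) :
    w ∈ formDomain (radialMeasure θ) (IsGuiTest θ) (fiberForm θ c) := by
  refine mem_formDomain_of_map (fun φ p => (√p.1)⁻¹ • φ p) (1 + 4 * c) hu
    (fun φ hφ => hφ.inv_sqrt_fst_smul) (fun φ _ => ?_) (fiberForm_nonneg hc)
    fun φ ψ hφ hψ => ?_
  · rw [eLpNorm_radialMeasure]
    refine (eLpNorm_congr_ae ?_).le
    filter_upwards [huw, ae_sqrt_fst_smul_inv φ] with p hp hφp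
    rw [hp, smul_sub, hφp]
  · have hbound := ((hφ.sub hψ).inv_sqrt_fst_smul.fiberForm_bounds hc).2
    rw [(hφ.sub hψ).sqrt_fst_smul_inv_sqrt_fst_smul] at hbound
    simp only [← smul_sub]
    exact hbound

theorem exists_L2Radial_eq_sqrt_smul (u : L2Flat θ) :
    ∃ w : L2Radial θ, u =ᵐ[flatMeasure θ] fun p => √p.1 • w p := by
  have hmeas : AEStronglyMeasurable (fun p => (√p.1)⁻¹ • u p) (flatMeasure θ) :=
    (by fun_prop : Measurable fun p : ℝ × ℝ => (√p.1)⁻¹).aestronglyMeasurable.smul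
      (Lp.aestronglyMeasurable u)
  have hmem : MemLp (fun p => (√p.1)⁻¹ • u p) 2 (radialMeasure θ) := by
    refine ⟨hmeas.mono_ac (withDensity_absolutelyContinuous _ _), ?_⟩
    rw [eLpNorm_radialMeasure, eLpNorm_congr_ae (ae_sqrt_fst_smul_inv u)]
    exact Lp.eLpNorm_lt_top u
  refine ⟨hmem.toLp _, ?_⟩
  have hcoe : ∀ᵐ p ∂flatMeasure θ, hmem.toLp _ p = (√p.1)⁻¹ • u p := by
    rw [← radialMeasure_ae_eq]
    exact hmem.coeFn_toLp
  filter_upwards [hcoe, ae_sqrt_fst_smul_inv u] with p hp hup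
  rw [hp, hup]

theorem flatFormDomain_eq_H10 (θ : ℝ) {ω : ℝ} {m : ℤ} (h : (m : ℝ) + ω ≠ 0) :
    flatFormDomain θ ω m = H10 θ := by
  rw [H10_eq_formDomain]
  ext u
  simp only [flatFormDomain, ← Complex.real_smul]
  constructor
  · rintro ⟨w, hw, huw⟩
    exact mem_formDomain_dirichletForm_of_fiberForm (sq_pos_of_ne_zero h) huw
      (fiberFormDomain_subset θ ω m hw)
  · intro hu
    obtain ⟨w, huw⟩ := exists_L2Radial_eq_sqrt_smul u
    exact ⟨w, formDomain_fiberForm_subset θ ω m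
      (mem_formDomain_fiberForm_of_dirichletForm (sq_nonneg _) huw hu), huw⟩

theorem testIsFormCore_of_flatFormDomain_eq_H10 {ω : ℝ} {m : ℤ}
    (h : flatFormDomain θ ω m = H10 θ) : TestIsFormCore θ ω m := by
  refine ⟨h ▸ testClasses_subset_H10 θ, fun u hu => ?_⟩
  rw [h] at hu
  obtain ⟨φ, hφ, hlim⟩ := hu.2
  exact ⟨φ, hφ, tendsto_flatFormNorm_sub ω m (fun n => testClasses_subset_H10 θ (hφ n)) hu hlim⟩

theorem intCast_add_ne_zero_of_mem_Ioo {ω : ℝ} (hω : ω ∈ Set.Ioo (0 : ℝ) 1) (m : ℤ) :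
    (m : ℝ) + ω ≠ 0 := by
  intro h
  have hlt : (m : ℝ) < (0 : ℤ) := by push_cast; linarith [hω.1]
  have hgt : ((-1 : ℤ) : ℝ) < m := by push_cast; linarith [hω.2]
  norm_cast at hlt hgt
  omega

end Flattening

end ConicalLayer

end

open ConicalLayer in
theorem propositionB1_general (θ ω : ℝ) (m : ℤ) (hadd : (m : ℝ) + ω ≠ 0)
    (hsub : (m : ℝ) - ω ≠ 0) :
    flatFormDomain θ ω m = H10 θ ∧
    TestIsFormCore θ ω m ∧
    (∀ u ∈ flatFormDomain θ ω m,
      Integrable (fun p : ℝ × ℝ => ‖u p‖ ^ 2 / p.1 ^ 2) (flatMeasure θ) ∧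
      0 ≤ flatForm θ ω m u) ∧
    ∃ C₁ C₂ : ℝ, 0 < C₁ ∧ 0 < C₂ ∧ ∀ u ∈ flatFormDomain θ ω m,
      C₁ * h1Norm θ u ≤ flatFormNorm θ ω m u ∧
      flatFormNorm θ ω m u ≤ C₂ * h1Norm θ u := by
  have hdom := flatFormDomain_eq_H10 θ hadd
  refine ⟨hdom, testIsFormCore_of_flatFormDomain_eq_H10 hdom, ?_⟩
  rw [hdom]
  refine ⟨fun u hu => ⟨integrable_norm_sq_div_sq hu, flatForm_nonneg ω m hu⟩, ?_⟩
  exact ⟨√(min 1 (4 * ((m : ℝ) - ω) ^ 2)), √(1 + 4 * ((m : ℝ) - ω) ^ 2), by positivity,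
    by positivity,
    fun u hu => ⟨mul_h1Norm_le_flatFormNorm ω m hu, flatFormNorm_le_mul_h1Norm ω m hu⟩⟩

theorem propositionB1 (θ : ℝ) (hθ : θ ∈ Set.Ioo 0 (Real.pi / 2))
    (ω : ℝ) (hω : ω ∈ Set.Ioc (0 : ℝ) (1 / 2)) (m : ℤ) :
    ConicalLayer.flatFormDomain θ ω m = ConicalLayer.H10 θ ∧
    ConicalLayer.TestIsFormCore θ ω m ∧
    (∀ u ∈ ConicalLayer.flatFormDomain θ ω m,
      Integrable (fun p : ℝ × ℝ => ‖u p‖ ^ 2 / p.1 ^ 2) (ConicalLayer.flatMeasure θ) ∧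
      0 ≤ ConicalLayer.flatForm θ ω m u) ∧
    ∃ C₁ C₂ : ℝ, 0 < C₁ ∧ 0 < C₂ ∧ ∀ u ∈ ConicalLayer.flatFormDomain θ ω m,
      C₁ * ConicalLayer.h1Norm θ u ≤ ConicalLayer.flatFormNorm θ ω m u ∧
      ConicalLayer.flatFormNorm θ ω m u ≤ C₂ * ConicalLayer.h1Norm θ u := by
  have hω' : ω ∈ Set.Ioo (0 : ℝ) 1 := ⟨hω.1, hω.2.trans_lt (by norm_num)⟩
  exact propositionB1_general θ ω m (ConicalLayer.intCast_add_ne_zero_of_mem_Ioo hω' m) fun h =>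
    ConicalLayer.intCast_add_ne_zero_of_mem_Ioo hω' (-m) (by push_cast; linarith)
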